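/- **Setting.** Let $N,M$ be positive integers, $A$ a compact subset of a Euclidean space, and let $f:\mathbb R^N\times\mathbb R^M\times A\to\mathbb R^N$, $g:\mathbb R^N\times\mathbb R^M\times A\to\mathbb R^M$, $\ell:\mathbb R^N\times\mathbb R^M\times A\to\mathbb R$ be such that: $f,g$ are continuous in $a\in A$ and Lipschitz continuous in $(x,y)$, uniformly in $a$; $|f|\le Q_0$; for every compact $K\subset\mathbb R^N\times\mathbb R^M$ there is $r>0$ with $B(0,r)\subset\overline{\mathrm{co}}\,g(x,y,A)$ for all $(x,y)\in K$; $\ell$ is continuous and $\lim_{|y|\to\infty}\min_{(x,a)\in B\times A}\ell(x,y,a)=+\infty$ for every compact $B\subset\mathbb R^N$. Fix $(x_0,p_0)\in\mathbb R^N\times\mathbb R^N$ and set $$H_0(y,q)=\max_{a\in A}\{-p_0\cdot f(x_0,y,a)-q\cdot g(x_0,y,a)-\ell(x_0,y,a)\},\qquad y,q\in\mathbb R^M .$$ Subsolutions are understood in the viscosity sense: $u$ is a subsolution of $H_0=b$ in an open set $B$ if it is upper semicontinuous there and $H_0(y,D\psi(y))\le b$ whenever $y\in B$ and $\psi$ is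 a $C^1$ function with $\psi(y)=u(y)$ and $\psi\ge u$ near $y$. It is strict in $B$ if it is a subsolution of $H_0=b-\delta$ in $B$ for some $\delta>0$. Let $$c_0=\inf\{b\in\mathbb R : H_0=b \text{ has a subsolution in } \mathbb R^M\}.$$ Let $Z(y)=\{q: H_0(y,q)\le c_0\}$, $\sigma(y,v)=\max\{q\cdot v: q\in Z(y)\}$, and let $S(y_1,y_2)$ be the infimum of $\int_0^1\sigma(\xi,\dot\xi)\,dt$ over the Lipschitz curves $\xi:[0,1]\to\mathbb R^M$ with $\xi(0)=y_1$, $\xi(1)=y_2$. **Proposition.** The critical value $c_0$ is finite, and: 1. There are a compact set $K\subset\mathbb R^M$ and a bounded, globally Lipschitz continuous subsolution $u$ of $H_0=c_0$ in $\mathbb R^M$ which vanishes outside $K$ and is strict in $\mathbb R^M\setminus K$. 2. Suppose that $Q_0$ is also an upper bound of $|g(x_0,\cdot,\cdot)|$. Then there are compact sets $C\subset\mathbb R^M$ with $H_0(y,0)<c_0-Q_0$ for all $y\in\mathbb R^M\setminus C$; and for each such $C$, the set $$K_0=\Bigl\{y : d(y,C)\le \max_{C\times C}|S|\Bigr\}$$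 is compact and there is $u$ as in 1 with $K=K_0$. -/

import Mathlib

open Set Topology
open scoped NNReal RealInnerProductSpace

noncomputable section

namespace CellProblem

/-- Euclidean space `ℝⁿ`. -/
abbrev E (n : ℕ) : Type := EuclideanSpace ℝ (Fin n)

/-- The standing assumptions on the control set `A`, the slow and fast controlled vector fields
`f`, `g` and the running cost `ℓ`; the number `Q₀` is an upper bound of `|f|`.
The functions are only looked at for controls in `A`. -/
structure StandingAssumptions {N M m : ℕ} (A : Set (E m)) (f : E N → E M → E m → E N)
    (g : E N → E M → E m → E M) (l : E N → E M → E m → ℝ) (Q₀ : ℝ) : Prop where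
  /-- the control set is compact -/
  isCompact : IsCompact A
  /-- the vector fields depend continuously on the control -/
  continuousOn_f : ∀ x y, ContinuousOn (f x y) A
  continuousOn_g : ∀ x y, ContinuousOn (g x y) A
  /-- the vector fields are Lipschitz in the state variables, uniformly in the control -/
  lipschitz : ∃ L₀ : ℝ, 0 < L₀ ∧ ∀ x₁ x₂ y₁ y₂, ∀ a ∈ A,
    ‖f x₁ y₁ a - f x₂ y₂ a‖ ≤ L₀ * (‖x₁ - x₂‖ + ‖y₁ - y₂‖) ∧
    ‖g x₁ y₁ a - g x₂ y₂ a‖ ≤ L₀ * (‖x₁ - x₂‖ + ‖y₁ - y₂‖)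
  /-- `|f|` is bounded by `Q₀` -/
  norm_f_le : ∀ x y, ∀ a ∈ A, ‖f x y a‖ ≤ Q₀
  /-- total controllability of the fast dynamics -/
  controllable : ∀ K : Set (E N × E M), IsCompact K → ∃ r : ℝ, 0 < r ∧ ∀ z ∈ K,
    Metric.ball (0 : E M) r ⊆ closure (convexHull ℝ (g z.1 z.2 '' A))
  /-- the running cost is continuous -/
  continuousOn_l : ContinuousOn (fun z : E N × E M × E m => l z.1 z.2.1 z.2.2)
    (univ ×ˢ univ ×ˢ A)
  /-- the running cost is coercive in the fast variable, uniformly for the slow variable in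
  a compact set and for the control in `A` -/
  coercive : ∀ B : Set (E N), IsCompact B → ∀ R : ℝ, ∃ ρ : ℝ, ∀ y : E M, ρ ≤ ‖y‖ →
    ∀ x ∈ B, ∀ a ∈ A, R ≤ l x y a

/-- The Hamiltonian
`H(x,y,p,q) = max_{a ∈ A} { - p · f(x,y,a) - q · g(x,y,a) - ℓ(x,y,a) }`. -/
def hamiltonian {N M m : ℕ} (A : Set (E m)) (f : E N → E M → E m → E N)
    (g : E N → E M → E m → E M) (l : E N → E M → E m → ℝ)
    (x : E N) (y : E M) (p : E N) (q : E M) : ℝ :=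
  sSup ((fun a => -⟪p, f x y a⟫ - ⟪q, g x y a⟫ - l x y a) '' A)

/-- `ψ` is supertangent to `u` at `y`: it is of class `C¹`, agrees with `u` at `y`, and is
`≥ u` near `y`. -/
def IsSupertangent {M : ℕ} (ψ u : E M → ℝ) (y : E M) : Prop :=
  ContDiff ℝ 1 ψ ∧ ψ y = u y ∧ ∀ᶠ z in 𝓝 y, u z ≤ ψ z

/-- `u` is a viscosity subsolution of `F(y,Du) = b` in the open set `B`. -/
def IsSubsolutionOn {M : ℕ} (F : E M → E M → ℝ) (b : ℝ) (B : Set (E M)) (u : E M → ℝ) : Prop :=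
  UpperSemicontinuousOn u B ∧
    ∀ y ∈ B, ∀ ψ : E M → ℝ, IsSupertangent ψ u y → F y (gradient ψ y) ≤ b

/-- `u` is a strict subsolution of `F(y,Du) = b` in the open set `B`. -/
def IsStrictSubsolutionOn {M : ℕ} (F : E M → E M → ℝ) (b : ℝ) (B : Set (E M))
    (u : E M → ℝ) : Prop :=
  ∃ δ : ℝ, 0 < δ ∧ IsSubsolutionOn F (b - δ) B u

/-- The values `b` for which `F(y,Du) = b` has a subsolution in the whole space. -/
def subsolutionLevels {M : ℕ} (F : E M → E M → ℝ) : Set ℝ :=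
  {b | ∃ u : E M → ℝ, IsSubsolutionOn F b univ u}

/-- The critical value of `F`. -/
def criticalValue {M : ℕ} (F : E M → E M → ℝ) : ℝ := sInf (subsolutionLevels F)

/-- The sublevel `Z_b(y) = {q | F(y,q) ≤ b}`. -/
def sublevel {M : ℕ} (F : E M → E M → ℝ) (b : ℝ) (y : E M) : Set (E M) := {q | F y q ≤ b}

/-- The support function `σ_b(y,v) = max {q · v | q ∈ Z_b(y)}`. -/
def support {M : ℕ} (F : E M → E M → ℝ) (b : ℝ) (y v : E M) : ℝ :=
  sSup ((fun q => ⟪q, v⟫) '' sublevel F b y)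

/-- The intrinsic length `∫₀¹ σ_b(ξ, ξ') dt` of a curve `ξ` defined in `[0,1]`. -/
def intrinsicLength {M : ℕ} (F : E M → E M → ℝ) (b : ℝ) (ξ : ℝ → E M) : ℝ :=
  ∫ t in (0 : ℝ)..1, support F b (ξ t) (deriv ξ t)

/-- The intrinsic distance `S_b(y₁,y₂)`: the infimum of the intrinsic lengths of the Lipschitz
curves defined in `[0,1]` that go from `y₁` to `y₂`. It need be neither symmetric nor
nonnegative. -/
def intrinsicDist {M : ℕ} (F : E M → E M → ℝ) (b : ℝ) (y₁ y₂ : E M) : ℝ :=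
  sInf {s | ∃ ξ : ℝ → E M, (∃ L : ℝ≥0, LipschitzOnWith L ξ (Icc 0 1)) ∧
    ξ 0 = y₁ ∧ ξ 1 = y₂ ∧ s = intrinsicLength F b ξ}

/-- `C` is a compact set with `F(y,0) < c - Q` for `y ∉ C`, `c` being the critical value. -/
def IsAdmissibleCore {M : ℕ} (F : E M → E M → ℝ) (Q : ℝ) (C : Set (E M)) : Prop :=
  IsCompact C ∧ ∀ y, y ∉ C → F y 0 < criticalValue F - Q

/-- The set `K₀ = {y | d(y,C) ≤ max_{C × C} |S|}`, `S` being the intrinsic distance at the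
critical value. -/
def coreNeighborhood {M : ℕ} (F : E M → E M → ℝ) (C : Set (E M)) : Set (E M) :=
  {y | Metric.infDist y C ≤
    sSup ((fun z : E M × E M => |intrinsicDist F (criticalValue F) z.1 z.2|) '' (C ×ˢ C))}

/-- `u` is a bounded, globally Lipschitz subsolution of the critical equation in the whole
space, which vanishes outside `K` and is strict there. -/
def IsSpecialSubsolution {M : ℕ} (F : E M → E M → ℝ) (K : Set (E M)) (u : E M → ℝ) : Prop :=
  (∃ R : ℝ, ∀ y, |u y| ≤ R) ∧ (∃ L : ℝ≥0, LipschitzWith L u) ∧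
    IsSubsolutionOn F (criticalValue F) univ u ∧
    (∀ y, y ∉ K → u y = 0) ∧ IsStrictSubsolutionOn F (criticalValue F) Kᶜ u

end CellProblem

end

namespace CellProblem

open Filter Metric MeasureTheory

variable {M : ℕ} {F : E M → E M → ℝ} {b c : ℝ} {u v w φ : E M → ℝ}

/-! ### Test functions -/

/-! The Hamiltonian `F = H₀` is coercive in `q` locally uniformly in `y` (controllability), has
convex sublevels, and `F y 0 → -∞` as `|y| → ∞` (coercivity of the cost), so constants are strict
subsolutions far away. Coercivity makes subsolutions locally equi-Lipschitz. This bounds the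
admissible levels from below and, by compactness, yields a subsolution `v` at the critical level
itself (`exists_critical_subsolution`).

The special subsolution is the truncation `max (min v φ) (-φ)`, with `φ ≥ 0` compactly supported, `φ
≥ |v|` on a compact set `C`, and `Dφ` so small off `C` that every `q` with `‖q‖ ≤ ‖Dφ‖` is
subcritical. Almost everywhere its gradient is `Dv`, `Dφ` or `-Dφ`, so it is an almost everywhere
subsolution; convexity of the sublevels and averaging make it a viscosity one
(`isSubsolutionOn_of_ae`). Where it vanishes identically only the gradient `0` is tested, whence
strictness (`isSpecialSubsolution_truncation`).

In general `g` grows at most linearly in `y`, and a logarithmic `φ`, whose slope is of order `1 / (1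
+ |y|)`, compensates this growth. If `|g| ≤ Q₀`, slope `1` costs at most `Q₀`, exactly the gap
available off `C`, so `φ = (m - d(·,C))⁺` works once `m` bounds the oscillation of `v` on `C`. The
choice `m = max |S|` is allowed because a subsolution increases along any curve by at most its
intrinsic length (`sub_le_intrinsicLength`). -/

theorem norm_gradient (f : E M → ℝ) (x : E M) : ‖gradient f x‖ = ‖fderiv ℝ f x‖ := by
  rw [gradient]; exact LinearIsometryEquiv.norm_map _ _

theorem gradient_eq_of_isLocalMax {y : E M} (hu : DifferentiableAt ℝ u y)
    (hv : DifferentiableAt ℝ v y) (h : IsLocalMax (fun z => u z - v z) y) :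
    gradient u y = gradient v y := by
  have h1 := h.fderiv_eq_zero
  rw [fderiv_fun_sub hu hv, sub_eq_zero] at h1
  rw [gradient, gradient, h1]

/-- A function of class `C¹` near a point coincides near that point with a `C¹` function. -/
theorem exists_contDiff_eventuallyEq {ψ : E M → ℝ} {z : E M} (h : ContDiffAt ℝ 1 ψ z) :
    ∃ ψ' : E M → ℝ, ContDiff ℝ 1 ψ' ∧ ψ' =ᶠ[𝓝 z] ψ := by
  obtain ⟨r, hr, hball⟩ := Metric.eventually_nhds_iff_ball.1 (h.eventually (by simp))
  let β : ContDiffBump z := ⟨r / 3, r / 2, by positivity, by linarith⟩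
  refine ⟨fun x => β x * ψ x, ?_, ?_⟩
  · rw [contDiff_iff_contDiffAt]
    intro x
    by_cases hx : x ∈ tsupport β
    · have hx' : x ∈ ball z r := by
        rw [β.tsupport_eq] at hx
        exact closedBall_subset_ball (by change r / 2 < r; linarith) hx
      exact β.contDiffAt.mul (hball x hx')
    · have : (fun x => β x * ψ x) =ᶠ[𝓝 x] fun _ => 0 := by
        filter_upwards [notMem_tsupport_iff_eventuallyEq.1 hx] with t ht
        simp [ht]
      exact contDiffAt_const.congr_of_eventuallyEq this
  · filter_upwards [β.eventuallyEq_one] with x hx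
    simp [hx]

/-- Only the germ and the gradient of a test function matter: a cutoff makes it globally `C¹`, and
adding a constant makes it touch `u`. Barriers involving `‖x - y‖`, not smooth at the centre,
thereby become admissible. -/
theorem IsSubsolutionOn.le_of_isLocalMax {B : Set (E M)} (hu : IsSubsolutionOn F b B u) {z : E M}
    (hz : z ∈ B) {ψ : E M → ℝ} (hψ : ContDiffAt ℝ 1 ψ z)
    (hmax : IsLocalMax (fun x => u x - ψ x) z) : F z (gradient ψ z) ≤ b := by
  obtain ⟨ψ', hψ', heq⟩ := exists_contDiff_eventuallyEq hψ
  have hg : gradient (fun x => ψ' x + (u z - ψ z)) z = gradient ψ z := by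
    rw [gradient, fderiv_add_const, heq.fderiv_eq, gradient]
  rw [← hg]
  refine hu.2 z hz _ ⟨hψ'.add contDiff_const, ?_, ?_⟩
  · simp [heq.eq_of_nhds]
  · filter_upwards [heq, hmax] with x hx hx2
    rw [hx]; linarith

/-- An upper semicontinuous function on a closed ball that is smaller on the sphere than at the
centre has a local maximum in the open ball. -/
theorem exists_isLocalMax_mem_ball {h : E M → ℝ} {y : E M} {r : ℝ} (hr : 0 < r)
    (husc : UpperSemicontinuousOn h (closedBall y r)) (hs : ∀ z, dist z y = r → h z < h y) :
    ∃ z ∈ ball y r, IsLocalMax h z ∧ ∀ x ∈ closedBall y r, h x ≤ h z := by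
  obtain ⟨z, hz, hmax⟩ := husc.exists_isMaxOn ⟨y, mem_closedBall_self hr.le⟩
    (isCompact_closedBall y r)
  have hzb : z ∈ ball y r := by
    rcases (mem_closedBall.1 hz).lt_or_eq with h1 | h1
    · exact h1
    · exact absurd (hmax (mem_closedBall_self hr.le)) (not_le.2 (hs z h1))
  refine ⟨z, hzb, ?_, fun x hx => hmax hx⟩
  filter_upwards [isOpen_ball.mem_nhds hzb] with x hx using hmax (ball_subset_closedBall hx)

theorem UpperSemicontinuousOn.sub_continuousOn {s : Set (E M)} {h k : E M → ℝ}
    (hh : UpperSemicontinuousOn h s) (hk : ContinuousOn k s) :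
    UpperSemicontinuousOn (fun x => h x - k x) s := by
  simpa [sub_eq_add_neg] using hh.add hk.neg.upperSemicontinuousOn

theorem gradient_add_norm_sq {ψ : E M → ℝ} {z : E M} (hψ : DifferentiableAt ℝ ψ z) (K : ℝ)
    (y : E M) :
    gradient (fun x => ψ x + K * ‖x - y‖ ^ 2) z = gradient ψ z + (2 * K) • (z - y) := by
  have h1 : HasFDerivAt (fun x : E M => ‖x - y‖ ^ 2) (2 • (innerSL ℝ (z - y))) z := by
    have := ((hasFDerivAt_id z).sub_const y).norm_sq
    simpa using this
  have h2 := (hψ.hasFDerivAt.add (h1.const_mul K))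
  apply ext_inner_right ℝ
  intro t
  rw [inner_gradient_left]
  erw [h2.fderiv]
  simp [inner_add_left, inner_smul_left, ← inner_gradient_left, inner_sub_left]
  ring

/-- The tangent plane at `y` need not lie above `u`. Adding a small paraboloid produces a local
maximum at a nearby point with a nearby test gradient, and continuity of `F` carries the inequality
back to `y`. -/
theorem IsSubsolutionOn.le_of_differentiableAt (hF : Continuous ↿F) {B : Set (E M)}
    (hB : IsOpen B) (hu : IsSubsolutionOn F b B u) {y : E M} (hy : y ∈ B)
    (hd : DifferentiableAt ℝ u y) : F y (gradient u y) ≤ b := by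
  set p := gradient u y with hp
  have key : ∀ δ : ℝ, 0 < δ → ∃ z q, dist z y ≤ δ ∧ dist q p ≤ 4 * δ ∧ F z q ≤ b := by
    intro δ hδ
    have h1 := hd.hasFDerivAt.isLittleO.bound hδ
    obtain ⟨r, hr, hball⟩ := Metric.nhds_basis_closedBall.eventually_iff.1
      (h1.and (hB.mem_nhds hy))
    set ρ := min r δ
    have hρ : 0 < ρ := lt_min hr hδ
    -- On the sphere the penalty is `K * ρ ^ 2 = 2 * δ * ρ`, which beats the linearization error `δ
    -- * ρ`; it changes the gradient by at most `2 * K * ρ = 4 * δ`.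
    set K := 2 * δ / ρ
    have hK : K * ρ = 2 * δ := by simp only [K]; field_simp
    have hK0 : 0 < K := by positivity
    let ψ : E M → ℝ := fun z => fderiv ℝ u y z + K * ‖z - y‖ ^ 2
    have hψ : ContDiff ℝ 1 ψ :=
      (fderiv ℝ u y).contDiff.add (contDiff_const.mul ((contDiff_id.sub contDiff_const).norm_sq ℝ))
    have hsub : closedBall y ρ ⊆ closedBall y r := closedBall_subset_closedBall (min_le_left _ _)
    obtain ⟨z, hz, hmax, -⟩ := exists_isLocalMax_mem_ball (h := fun x => u x - ψ x) hρ
      (UpperSemicontinuousOn.sub_continuousOn (hu.1.mono fun x hx => (hball (hsub hx)).2)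
        hψ.continuous.continuousOn) (by
        intro z hz
        have h2 := (hball (hsub (mem_closedBall.2 hz.le))).1
        rw [dist_eq_norm] at hz
        rw [hz, Real.norm_eq_abs, map_sub] at h2
        have h3 := (abs_le.1 h2).2
        simp only [ψ, hz, sub_self, norm_zero]
        nlinarith [mul_pos hδ hρ])
    refine ⟨z, gradient ψ z, (mem_ball.1 hz).le.trans (min_le_right _ _), ?_,
      hu.le_of_isLocalMax (hball (hsub (ball_subset_closedBall hz))).2 hψ.contDiffAt hmax⟩
    have hg : gradient ψ z = p + (2 * K) • (z - y) := by
      rw [gradient_add_norm_sq (fderiv ℝ u y).differentiableAt]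
      congr 1
      rw [hp, gradient, gradient, ContinuousLinearMap.fderiv]
    rw [hg, dist_eq_norm, add_sub_cancel_left, norm_smul, Real.norm_eq_abs, abs_of_pos (by positivity)]
    have := (mem_ball.1 hz).le
    rw [dist_eq_norm] at this
    nlinarith
  choose! z q hz hq hb using key
  have hzt : Tendsto z (𝓝[>] 0) (𝓝 y) := by
    rw [tendsto_iff_dist_tendsto_zero]
    refine squeeze_zero' (Eventually.of_forall fun _ => dist_nonneg)
      (eventually_mem_nhdsWithin.mono fun δ hδ => hz δ hδ) ?_
    exact tendsto_nhdsWithin_of_tendsto_nhds tendsto_id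
  have hqt : Tendsto q (𝓝[>] 0) (𝓝 p) := by
    rw [tendsto_iff_dist_tendsto_zero]
    refine squeeze_zero' (Eventually.of_forall fun _ => dist_nonneg)
      (eventually_mem_nhdsWithin.mono fun δ hδ => hq δ hδ) ?_
    refine tendsto_nhdsWithin_of_tendsto_nhds (Continuous.tendsto' (by fun_prop) _ _ (by simp))
  have hlim : Tendsto (fun δ => F (z δ) (q δ)) (𝓝[>] 0) (𝓝 (F y p)) :=
    (hF.tendsto (y, p)).comp (hzt.prodMk_nhds hqt)
  exact le_of_tendsto hlim (eventually_mem_nhdsWithin.mono fun δ hδ => hb δ hδ)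

/-- Viscosity subsolutions are stable under locally uniform approximation. -/
theorem isSubsolutionOn_of_approx (hF : Continuous ↿F) (hu : Continuous u)
    (h : ∀ y, ∃ R : ℝ, 0 < R ∧ ∀ η : ℝ, 0 < η → ∃ w, IsSubsolutionOn F (b + η) (ball y R) w ∧
      ∀ z ∈ ball y R, |w z - u z| ≤ η) : IsSubsolutionOn F b univ u := by
  refine ⟨hu.upperSemicontinuous.upperSemicontinuousOn _, ?_⟩
  rintro y - ψ ⟨hψ, hψy, hle⟩
  obtain ⟨R, hR, happ⟩ := h y
  obtain ⟨r₀, hr₀, hball⟩ := Metric.nhds_basis_closedBall.eventually_iff.1 hle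
  have key : ∀ δ : ℝ, 0 < δ → ∃ z, dist z y ≤ δ ∧ F z (gradient ψ z + (2 : ℝ) • (z - y)) ≤ b + δ := by
    intro δ hδ
    obtain ⟨r, hr, hrlt⟩ := exists_between (lt_min (lt_min hR hr₀) hδ)
    have hrR : r < R := hrlt.trans_le ((min_le_left _ _).trans (min_le_left _ _))
    have hrr : r < r₀ := hrlt.trans_le ((min_le_left _ _).trans (min_le_right _ _))
    have hrδ : r < δ := hrlt.trans_le (min_le_right _ _)
    -- The paraboloid is worth `r ^ 2` on the sphere, while replacing `u` by `w` costs at most `2 *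
    -- (r ^ 2 / 4)`, so the maximum stays inside.
    obtain ⟨w, hw, hwu⟩ := happ (min δ (r ^ 2 / 4)) (by positivity)
    have hsub : closedBall y r ⊆ ball y R := closedBall_subset_ball hrR
    have hψ1 : ContDiff ℝ 1 fun x => ψ x + 1 * ‖x - y‖ ^ 2 :=
      hψ.add (contDiff_const.mul ((contDiff_id.sub contDiff_const).norm_sq ℝ))
    obtain ⟨z, hz, hmax, -⟩ := exists_isLocalMax_mem_ball
      (h := fun x => w x - (ψ x + 1 * ‖x - y‖ ^ 2)) hr
      (UpperSemicontinuousOn.sub_continuousOn (hw.1.mono hsub) hψ1.continuous.continuousOn) (by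
        intro z hz
        have hzc : z ∈ closedBall y r := mem_closedBall.2 hz.le
        have h1 := (abs_le.1 (hwu z (hsub hzc))).2
        have h2 := (abs_le.1 (hwu y (mem_ball_self hR))).1
        have h3 := hball (closedBall_subset_closedBall hrr.le hzc)
        have h4 := min_le_right δ (r ^ 2 / 4)
        rw [dist_eq_norm] at hz
        simp only [hz, sub_self, norm_zero]
        nlinarith [pow_pos hr 2])
    refine ⟨z, (mem_ball.1 hz).le.trans hrδ.le, ?_⟩
    have := hw.le_of_isLocalMax (hsub (ball_subset_closedBall hz)) hψ1.contDiffAt hmax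
    rw [gradient_add_norm_sq (hψ.differentiable (by simp)).differentiableAt, mul_one] at this
    exact this.trans (by linarith [min_le_left δ (r ^ 2 / 4)])
  choose! z hz hb using key
  have hzt : Tendsto z (𝓝[>] 0) (𝓝 y) := by
    rw [tendsto_iff_dist_tendsto_zero]
    refine squeeze_zero' (Eventually.of_forall fun _ => dist_nonneg)
      (eventually_mem_nhdsWithin.mono fun δ hδ => hz δ hδ) ?_
    exact tendsto_nhdsWithin_of_tendsto_nhds tendsto_id
  have hgc : Continuous (gradient ψ) :=
    (LinearIsometryEquiv.continuous _).comp (hψ.continuous_fderiv (by simp))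
  have hqt : Tendsto (fun δ => gradient ψ (z δ) + (2 : ℝ) • (z δ - y)) (𝓝[>] 0)
      (𝓝 (gradient ψ y)) := by
    have : Continuous fun x => gradient ψ x + (2 : ℝ) • (x - y) := by fun_prop
    have h0 := (this.tendsto y).comp hzt
    rwa [sub_self, smul_zero, add_zero] at h0
  have hlim := (hF.tendsto (y, gradient ψ y)).comp (hzt.prodMk_nhds hqt)
  refine le_of_tendsto_of_tendsto hlim (g := fun δ : ℝ => b + δ) (b := 𝓝[>] 0)
    (tendsto_nhdsWithin_of_tendsto_nhds (Continuous.tendsto' (by fun_prop) _ _ (by simp)))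
    (eventually_mem_nhdsWithin.mono fun δ hδ => hb δ hδ)

/-- A differentiable function is a viscosity subsolution as soon as it is a pointwise one. -/
theorem isSubsolutionOn_of_differentiable {B : Set (E M)} (hw : Differentiable ℝ w)
    (h : ∀ y ∈ B, F y (gradient w y) ≤ b) : IsSubsolutionOn F b B w := by
  refine ⟨hw.continuous.upperSemicontinuous.upperSemicontinuousOn _, ?_⟩
  rintro y hy ψ ⟨hψ, hψy, hle⟩
  rw [← gradient_eq_of_isLocalMax (hw y) (hψ.differentiable (by simp) y)]
  · exact h y hy
  · filter_upwards [hle] with x hx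
    linarith

/-! ### Local Lipschitz continuity of subsolutions -/

/-- If all supertangents to `u` in a ball have a gradient of norm less than `L`, then `u` grows
from the centre at most like a logarithmic barrier. -/
theorem IsSubsolutionOn.le_add_barrier {B : Set (E M)} (hu : IsSubsolutionOn F b B u) {L ρ : ℝ}
    (hL : 0 < L) (hρ : 0 < ρ) {y : E M} (hB : closedBall y ρ ⊆ B)
    (hF : ∀ z ∈ ball y ρ, ∀ q, F z q ≤ b → ‖q‖ < L) {x : E M} (hx : x ∈ ball y ρ) :
    u x ≤ u y + L * (-ρ * Real.log (1 - ‖x - y‖ / ρ)) := by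
  by_contra! hlt
  set h : ℝ → ℝ := fun s => L * (-ρ * Real.log (1 - s / ρ)) with hh
  obtain ⟨U, hU⟩ := (hu.1.mono hB).bddAbove_of_isCompact (isCompact_closedBall y ρ)
  have hxρ : ‖x - y‖ < ρ := by rwa [mem_ball, dist_eq_norm] at hx
  -- The barrier `h` blows up at `ρ`; `T` and `r` are chosen so that `h r` exceeds `U - u y` by at
  -- least `1`, which keeps the maximum of `u - h` off the sphere of radius `r`.
  set T := max 0 (U - u y + 1) / (L * ρ) with hT
  have hT0 : 0 ≤ T := by positivity
  set r := max (max ‖x - y‖ (ρ / 2)) (ρ * (1 - Real.exp (-T))) with hr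
  have hr0 : 0 < r := lt_of_lt_of_le (by positivity) ((le_max_right _ _).trans (le_max_left _ _))
  have hrρ : r < ρ := by
    refine max_lt (max_lt hxρ (by linarith)) ?_
    nlinarith [Real.exp_pos (-T)]
  have hpos : ∀ s, s < ρ → 0 < 1 - s / ρ := fun s hs => by
    rw [sub_pos, div_lt_one hρ]; exact hs
  have hhr : U - u y + 1 ≤ h r := by
    have h1 : Real.log (1 - r / ρ) ≤ -T := by
      rw [Real.log_le_iff_le_exp (hpos r hrρ)]
      have h2 : ρ * (1 - Real.exp (-T)) ≤ r := le_max_right _ _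
      have h3 : 1 - Real.exp (-T) ≤ r / ρ := by
        rw [le_div_iff₀ hρ]; linarith
      linarith
    have h4 : T * (L * ρ) = max 0 (U - u y + 1) := by rw [hT]; field_simp
    have h5 := le_max_right 0 (U - u y + 1)
    have h6 : L * ρ * T ≤ L * ρ * -Real.log (1 - r / ρ) :=
      mul_le_mul_of_nonneg_left (by linarith) (by positivity)
    simp only [hh]
    nlinarith
  have hsub : closedBall y r ⊆ ball y ρ := closedBall_subset_ball hrρ
  have hcont : ContinuousOn (fun z => h ‖z - y‖) (closedBall y r) := by
    refine ContinuousOn.mul continuousOn_const (ContinuousOn.mul continuousOn_const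
      (ContinuousOn.log (by fun_prop) fun z hz => (hpos _ ?_).ne'))
    have := hsub hz
    rwa [mem_ball, dist_eq_norm] at this
  have hh0 : h 0 = 0 := by simp [hh]
  obtain ⟨z, hz, hmax, hmax2⟩ := exists_isLocalMax_mem_ball
    (h := fun x => u x - h ‖x - y‖) hr0
    (UpperSemicontinuousOn.sub_continuousOn
      (hu.1.mono ((closedBall_subset_closedBall hrρ.le).trans hB)) hcont) (by
      intro z hz
      have h1 : u z ≤ U := hU ⟨z, closedBall_subset_closedBall hrρ.le (mem_closedBall.2 hz.le), rfl⟩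
      rw [dist_eq_norm] at hz
      simp only [hz, sub_self, norm_zero, hh0]
      linarith)
  -- The assumed violation at `x` makes `u - h` larger there than at the centre, the only point of
  -- the ball where the barrier may fail to be differentiable.
  have hzy : z ≠ y := by
    rintro rfl
    have := hmax2 x (by
      rw [mem_closedBall, dist_eq_norm]; exact (le_max_left _ _).trans (le_max_left _ _))
    simp only [sub_self, norm_zero, hh0] at this
    linarith
  have hzρ : ‖z - y‖ < ρ := by
    have := hsub (ball_subset_closedBall hz); rwa [mem_ball, dist_eq_norm] at this
  set d := ‖z - y‖ with hd
  have hd0 : 0 < d := norm_pos_iff.2 (sub_ne_zero.2 hzy)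
  have hψ : ContDiffAt ℝ 1 (fun x => h ‖x - y‖) z := by
    refine contDiffAt_const.mul (contDiffAt_const.mul (ContDiffAt.log ?_ (hpos _ hzρ).ne'))
    exact contDiffAt_const.sub
      ((((contDiffAt_id.sub contDiffAt_const).norm ℝ (sub_ne_zero.2 hzy))).div_const _)
  have hle := hu.le_of_isLocalMax (hB (ball_subset_closedBall (hsub (ball_subset_closedBall hz))))
    hψ hmax
  have hlt := hF z (hsub (ball_subset_closedBall hz)) _ hle
  set p := gradient (fun x => h ‖x - y‖) z with hp
  -- the derivative of the barrier in the radial direction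
  have hline : HasDerivAt (fun t : ℝ => z + t • (z - y)) (z - y) 0 := by
    simpa using ((hasDerivAt_id (0 : ℝ)).smul_const (z - y)).const_add z
  have h1 : HasDerivAt (fun t : ℝ => h ‖z + t • (z - y) - y‖) ⟪p, z - y⟫ 0 := by
    have hf : HasFDerivAt (fun x => h ‖x - y‖) (fderiv ℝ (fun x => h ‖x - y‖) z)
        (z + (0 : ℝ) • (z - y)) := by
      simpa using (hψ.differentiableAt (by simp)).hasFDerivAt
    have := hf.comp_hasDerivAt (0 : ℝ) hline
    rw [inner_gradient_left]
    exact this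
  have h2 : HasDerivAt (fun t : ℝ => h ((1 + t) * d)) (L * (-ρ * (-(d / ρ) / (1 - d / ρ)))) 0 := by
    have h3 : HasDerivAt (fun t : ℝ => 1 - (1 + t) * d / ρ) (-(d / ρ)) 0 := by
      have := ((((hasDerivAt_id (0 : ℝ)).const_add 1).mul_const d).div_const ρ).const_sub 1
      simpa using this
    have := h3.log (by simpa using (hpos d hzρ).ne')
    rw [add_zero, one_mul] at this
    exact (this.const_mul (-ρ)).const_mul L
  have heq : (fun t : ℝ => h ‖z + t • (z - y) - y‖) =ᶠ[𝓝 0] fun t => h ((1 + t) * d) := by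
    filter_upwards [lt_mem_nhds (show (-1 : ℝ) < 0 by norm_num)] with t ht
    have : z + t • (z - y) - y = (1 + t) • (z - y) := by rw [add_smul, one_smul]; abel
    rw [this, norm_smul, Real.norm_eq_abs, abs_of_pos (by linarith)]
  have h4 := h1.unique (h2.congr_of_eventuallyEq heq)
  -- The barrier has slope `L / (1 - s / ρ) ≥ L` at distance `s`, which contradicts `‖p‖ < L`.
  have h5 : L * d ≤ ⟪p, z - y⟫ := by
    rw [h4]
    have h6 : -ρ * (-(d / ρ) / (1 - d / ρ)) = d / (1 - d / ρ) := by field_simp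
    rw [h6]
    refine mul_le_mul_of_nonneg_left ?_ hL.le
    rw [le_div_iff₀ (hpos d hzρ)]
    have : 0 < d / ρ := by positivity
    nlinarith
  have h7 := real_inner_le_norm p (z - y)
  rw [← hd] at h7
  nlinarith

/-- Subsolutions of a coercive equation are Lipschitz continuous in balls, with a constant that
depends only on the bound for the gradients. -/
theorem IsSubsolutionOn.abs_sub_le (hu : IsSubsolutionOn F b univ u) {L R : ℝ} (hL : 0 < L)
    (hR : 0 < R) (hF : ∀ z, ‖z‖ ≤ 5 * R → ∀ q, F z q ≤ b → ‖q‖ < L) {x y : E M}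
    (hx : ‖x‖ ≤ R) (hy : ‖y‖ ≤ R) : |u x - u y| ≤ 2 * L * ‖x - y‖ := by
  have key : ∀ x y : E M, ‖x‖ ≤ R → ‖y‖ ≤ R → u x - u y ≤ 2 * L * ‖x - y‖ := by
    intro x y hx hy
    have hxy : ‖x - y‖ ≤ 2 * R := (norm_sub_le x y).trans (by linarith)
    -- Radius `4 * R` keeps the ball around `y` inside the ball of radius `5 * R` and makes `s = ‖x
    -- - y‖ / (4 * R)` at most `1 / 2`, where `-log (1 - s) ≤ 2 * s`; hence the constant `2 * L`.
    have h := hu.le_add_barrier (y := y) (x := x) (ρ := 4 * R) hL (by positivity) (subset_univ _)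
      (fun z hz q => hF z (by
        rw [mem_ball, dist_eq_norm] at hz
        have := norm_le_norm_add_norm_sub' z y
        linarith) q) (by rw [mem_ball, dist_eq_norm]; linarith)
    set s := ‖x - y‖ / (4 * R) with hs
    have hs0 : 0 ≤ s := by positivity
    have hs2 : s ≤ 1 / 2 := by rw [hs, div_le_iff₀ (by positivity)]; linarith
    have hlog : -Real.log (1 - s) ≤ 2 * s := by
      have h1 := Real.one_sub_inv_le_log_of_pos (show 0 < 1 - s by linarith)
      have h2 : (1 - s)⁻¹ ≤ 1 + 2 * s := by
        rw [inv_le_iff_one_le_mul₀ (by linarith)]; nlinarith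
      linarith
    have hsR : s * (4 * R) = ‖x - y‖ := by rw [hs]; field_simp
    have h3 : L * (4 * R) * -Real.log (1 - s) ≤ L * (4 * R) * (2 * s) :=
      mul_le_mul_of_nonneg_left hlog (by positivity)
    nlinarith
  rw [abs_le]
  have h1 := key x y hx hy
  have h2 := key y x hy hx
  rw [norm_sub_rev] at h2
  constructor <;> linarith

/-- A locally Lipschitz function is differentiable almost everywhere. -/
theorem ae_differentiableAt_of_locallyLipschitz
    (h : ∀ R : ℝ, ∃ L : ℝ≥0, LipschitzOnWith L u (closedBall 0 R)) :
    ∀ᵐ x, DifferentiableAt ℝ u x := by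
  have : ∀ n : ℕ, ∀ᵐ x, x ∈ closedBall (0 : E M) n →
      DifferentiableWithinAt ℝ u (closedBall 0 n) x := by
    intro n
    obtain ⟨L, hL⟩ := h n
    exact hL.ae_differentiableWithinAt_of_mem
  filter_upwards [ae_all_iff.2 this] with x hx
  obtain ⟨n, hn⟩ := exists_nat_gt ‖x‖
  refine (hx n (by simpa using hn.le)).differentiableAt ?_
  exact mem_of_superset (isOpen_ball.mem_nhds (by simpa using hn)) ball_subset_closedBall

/-! ### Critical subsolutions -/

/-- The properties of the Hamiltonian `H₀` on which the construction of special critical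
subsolutions rests. -/
structure IsCoerciveHamiltonian (F : E M → E M → ℝ) : Prop where
  continuous : Continuous ↿F
  convex : ∀ b y, Convex ℝ (sublevel F b y)
  coercive : ∀ R : ℝ, ∃ r : ℝ, 0 < r ∧ ∃ C : ℝ, ∀ y : E M, ‖y‖ ≤ R → ∀ q, r * ‖q‖ - C ≤ F y q
  decay : ∀ T : ℝ, ∃ ρ : ℝ, ∀ y : E M, ρ ≤ ‖y‖ → F y 0 ≤ T
  growth : ∃ G : ℝ, 0 < G ∧ ∀ y q, F y q ≤ F y 0 + G * (1 + ‖y‖) * ‖q‖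

theorem IsSubsolutionOn.mono {B B' : Set (E M)} (hu : IsSubsolutionOn F b B u) (hb : b ≤ c)
    (hB : B' ⊆ B) : IsSubsolutionOn F c B' u :=
  ⟨hu.1.mono hB, fun y hy ψ hψ => (hu.2 y (hB hy) ψ hψ).trans hb⟩

theorem IsSubsolutionOn.sub_const {B : Set (E M)} (hu : IsSubsolutionOn F b B u) (k : ℝ) :
    IsSubsolutionOn F b B fun y => u y - k := by
  refine ⟨UpperSemicontinuousOn.sub_continuousOn hu.1 continuousOn_const, ?_⟩
  rintro y hy ψ ⟨hψ, hψy, hle⟩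
  refine hu.le_of_isLocalMax hy hψ.contDiffAt ?_
  filter_upwards [hle] with x hx
  linarith

theorem mem_subsolutionLevels (h : ∀ y, F y 0 ≤ b) : b ∈ subsolutionLevels F := by
  refine ⟨fun _ => 0, isSubsolutionOn_of_differentiable (differentiable_const _) fun y _ => ?_⟩
  rw [gradient_fun_const]
  exact h y

namespace IsCoerciveHamiltonian

variable (hF : IsCoerciveHamiltonian F)
include hF

theorem continuous_zero : Continuous fun y => F y 0 :=
  hF.continuous.comp (continuous_id.prodMk continuous_const)

theorem isClosed_sublevel (b : ℝ) (y : E M) : IsClosed (sublevel F b y) :=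
  isClosed_le (hF.continuous.comp (continuous_const.prodMk continuous_id)) continuous_const

theorem exists_norm_lt (R b : ℝ) :
    ∃ L : ℝ, 0 < L ∧ ∀ y : E M, ‖y‖ ≤ R → ∀ q, F y q ≤ b → ‖q‖ < L := by
  obtain ⟨r, hr, C, hC⟩ := hF.coercive R
  refine ⟨max 0 ((b + C) / r) + 1, by positivity, fun y hy q hq => ?_⟩
  have h1 : ‖q‖ ≤ (b + C) / r := by
    rw [le_div_iff₀ hr]; linarith [hC y hy q]
  linarith [le_max_right 0 ((b + C) / r)]

theorem exists_lipschitz (R b : ℝ) : ∃ L : ℝ, 0 < L ∧ ∀ b' ≤ b, ∀ u : E M → ℝ,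
    IsSubsolutionOn F b' univ u → ∀ x y, ‖x‖ ≤ R → ‖y‖ ≤ R → |u x - u y| ≤ L * ‖x - y‖ := by
  obtain ⟨L, hL, h⟩ := hF.exists_norm_lt (5 * max R 1) b
  refine ⟨2 * L, by positivity, fun b' hb' u hu x y hx hy => ?_⟩
  exact hu.abs_sub_le hL (by positivity) (fun z hz q hq => h z hz q (hq.trans hb'))
    (hx.trans (le_max_left _ _)) (hy.trans (le_max_left _ _))

theorem lipschitzOnWith (hu : IsSubsolutionOn F b univ u) (R : ℝ) :
    ∃ L : ℝ≥0, LipschitzOnWith L u (closedBall 0 R) := by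
  obtain ⟨L, hL, h⟩ := hF.exists_lipschitz R b
  refine ⟨⟨L, hL.le⟩, LipschitzOnWith.of_dist_le_mul fun x hx y hy => ?_⟩
  rw [Real.dist_eq, dist_eq_norm]
  exact h b le_rfl u hu x y (by simpa using hx) (by simpa using hy)

theorem exists_forall_zero_le : ∃ T : ℝ, ∀ y, F y 0 ≤ T := by
  obtain ⟨ρ, hρ⟩ := hF.decay 0
  obtain ⟨U, hU⟩ := (isCompact_closedBall (0 : E M) ρ).bddAbove_image
    hF.continuous_zero.continuousOn
  refine ⟨max U 0, fun y => ?_⟩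
  rcases le_total ‖y‖ ρ with h | h
  · exact (hU ⟨y, by simpa using h, rfl⟩).trans (le_max_left _ _)
  · exact (hρ y h).trans (le_max_right _ _)

/-- Any subsolution is locally Lipschitz, hence differentiable somewhere in the unit ball, and there
its level is at least the lower bound of `F` given by coercivity. -/
theorem bddBelow_subsolutionLevels : BddBelow (subsolutionLevels F) := by
  obtain ⟨r, hr, C, hC⟩ := hF.coercive 1
  refine ⟨-C, ?_⟩
  rintro b ⟨u, hu⟩
  have hae := ae_differentiableAt_of_locallyLipschitz (hF.lipschitzOnWith hu)
  have hpos : (volume (ball (0 : E M) 1)) ≠ 0 := (measure_ball_pos _ _ one_pos).ne'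
  obtain ⟨y, hy, hd⟩ : ∃ y ∈ ball (0 : E M) 1, DifferentiableAt ℝ u y := by
    by_contra! hcon
    exact hpos (measure_mono_null (fun y hy => hcon y hy) (ae_iff.1 hae))
  have h1 := hu.le_of_differentiableAt hF.continuous isOpen_univ (mem_univ y) hd
  have h2 := hC y (by simpa using (mem_ball.1 hy).le) (gradient u y)
  have : 0 ≤ r * ‖gradient u y‖ := by positivity
  linarith

theorem isGLB_criticalValue : IsGLB (subsolutionLevels F) (criticalValue F) := by
  obtain ⟨T, hT⟩ := hF.exists_forall_zero_le
  exact isGLB_csInf ⟨T, mem_subsolutionLevels hT⟩ hF.bddBelow_subsolutionLevels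

/-- The critical equation has a subsolution. -/
theorem exists_critical_subsolution : ∃ v, IsSubsolutionOn F (criticalValue F) univ v := by
  set c := criticalValue F
  have hc : ∀ n : ℕ, ∃ b u, b < c + 1 / ((n : ℝ) + 1) ∧ IsSubsolutionOn F b univ u ∧ u 0 = 0 := by
    intro n
    obtain ⟨b, ⟨u, hu⟩, -, hb⟩ := hF.isGLB_criticalValue.exists_between
      (show c < c + 1 / ((n : ℝ) + 1) by simp; positivity)
    exact ⟨b, fun y => u y - u 0, hb, hu.sub_const _, sub_self _⟩
  choose β U hβ hU hU0 using hc
  have hβ1 : ∀ n, β n ≤ c + 1 := fun n => (hβ n).le.trans (by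
    have : 1 / ((n : ℝ) + 1) ≤ 1 := by
      rw [div_le_one (by positivity)]; linarith [(Nat.cast_nonneg n : (0 : ℝ) ≤ n)]
    linarith)
  -- The normalization `U n 0 = 0` and the common Lipschitz bound confine `U n y` to a compact
  -- interval. Limits along one nonprincipal ultrafilter then exist at all points at once, in place
  -- of a diagonal extraction.
  have hlim : ∀ y, ∃ s, Tendsto (fun n => U n y) (hyperfilter ℕ) (𝓝 s) := by
    intro y
    obtain ⟨L, hL, h⟩ := hF.exists_lipschitz ‖y‖ (c + 1)
    obtain ⟨s, -, hs⟩ := (isCompact_Icc (a := -(L * ‖y‖)) (b := L * ‖y‖)).ultrafilter_le_nhds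
      ((hyperfilter ℕ).map fun n => U n y) (by
        rw [le_principal_iff]
        refine Ultrafilter.mem_map.2 (univ_mem' fun n => ?_)
        have := h _ (hβ1 n) _ (hU n) y 0 le_rfl (by simp)
        rw [hU0, sub_zero, sub_zero] at this
        exact abs_le.1 this)
    exact ⟨s, hs⟩
  choose u hu using hlim
  have hlip : ∀ R : ℝ, ∃ L : ℝ, 0 < L ∧ (∀ n x y, ‖x‖ ≤ R → ‖y‖ ≤ R →
      |U n x - U n y| ≤ L * ‖x - y‖) ∧ ∀ x y, ‖x‖ ≤ R → ‖y‖ ≤ R → |u x - u y| ≤ L * ‖x - y‖ := by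
    intro R
    obtain ⟨L, hL, h⟩ := hF.exists_lipschitz R (c + 1)
    refine ⟨L, hL, fun n => h _ (hβ1 n) _ (hU n), fun x y hx hy => ?_⟩
    exact le_of_tendsto ((hu x).sub (hu y)).abs
      (Eventually.of_forall fun n => h _ (hβ1 n) _ (hU n) x y hx hy)
  have hcont : Continuous u := by
    rw [continuous_iff_continuousAt]
    intro y
    obtain ⟨L, hL, -, h⟩ := hlip (‖y‖ + 1)
    have : LipschitzOnWith ⟨L, hL.le⟩ u (closedBall 0 (‖y‖ + 1)) :=
      LipschitzOnWith.of_dist_le_mul fun x hx z hz => by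
        rw [Real.dist_eq, dist_eq_norm]
        exact h x z (by simpa using hx) (by simpa using hz)
    exact this.continuousOn.continuousAt
      (mem_of_superset (isOpen_ball.mem_nhds (by simp)) ball_subset_closedBall)
  refine ⟨u, isSubsolutionOn_of_approx hF.continuous hcont fun y => ⟨1, one_pos, fun η hη => ?_⟩⟩
  obtain ⟨L, hL, h1, h2⟩ := hlip (‖y‖ + 1)
  -- Equi-Lipschitz bounds and a finite net of mesh `η / (3 * L)` turn pointwise convergence into
  -- uniform convergence on the ball: three errors of `η / 3`.
  obtain ⟨t, htb, htf, hcov⟩ := (isCompact_closedBall y 1).finite_cover_balls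
    (show 0 < η / (3 * L) by positivity)
  have hev : ∀ᶠ n in (hyperfilter ℕ : Filter ℕ), ∀ x ∈ t, |U n x - u x| < η / 3 := by
    rw [eventually_all_finite htf]
    intro x _
    have := (hu x).sub_const (u x)
    rw [sub_self] at this
    have := this.abs
    rw [abs_zero] at this
    exact this.eventually (gt_mem_nhds (by positivity))
  have hev2 : ∀ᶠ n : ℕ in (hyperfilter ℕ : Filter ℕ), 1 / ((n : ℝ) + 1) < η :=
    Nat.hyperfilter_le_atTop (tendsto_one_div_add_atTop_nhds_zero_nat.eventually (gt_mem_nhds hη))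
  obtain ⟨n, hn1, hn2⟩ := (hev.and hev2).exists
  refine ⟨U n, (hU n).mono (by linarith [hβ n]) (subset_univ _), fun z hz => ?_⟩
  have hzn : ∀ z ∈ closedBall y 1, ‖z‖ ≤ ‖y‖ + 1 := fun z hz => by
    rw [mem_closedBall, dist_eq_norm] at hz
    linarith [norm_le_norm_add_norm_sub' z y]
  obtain ⟨x, hx, hzx⟩ := mem_iUnion₂.1 (hcov (ball_subset_closedBall hz))
  rw [mem_ball, dist_eq_norm, lt_div_iff₀ (by positivity)] at hzx
  have hzR := hzn z (ball_subset_closedBall hz)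
  have hxR := hzn x (htb hx)
  have a1 := abs_le.1 (h1 n z x hzR hxR)
  have a2 := abs_le.1 (h2 z x hzR hxR)
  have a3 := abs_lt.1 (hn1 x hx)
  rw [abs_le]
  constructor <;> nlinarith

end IsCoerciveHamiltonian

/-! ### Almost everywhere subsolutions -/

theorem norm_gradient_le {L : ℝ≥0} (hu : LipschitzWith L u) (y : E M) : ‖gradient u y‖ ≤ L := by
  rw [norm_gradient]; exact norm_fderiv_le_of_lipschitz ℝ hu

theorem measurable_gradient (u : E M → ℝ) : Measurable (gradient u) :=
  (LinearIsometryEquiv.continuous _).measurable.comp (measurable_fderiv ℝ u)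

/-- A Lipschitz almost everywhere subsolution is approximated by its averages over small balls,
which are differentiable and almost subsolutions. -/
theorem IsCoerciveHamiltonian.exists_differentiable_approx (hF : IsCoerciveHamiltonian F)
    {L : ℝ≥0} (hu : LipschitzWith L u) (hae : ∀ᵐ y, F y (gradient u y) ≤ b) (R : ℝ) {η : ℝ}
    (hη : 0 < η) : ∃ w : E M → ℝ, Differentiable ℝ w ∧ LipschitzWith L w ∧
      (∀ y, |w y - u y| ≤ η) ∧ ∀ y, ‖y‖ ≤ R → F y (gradient w y) ≤ b + η := by
  have hcpt : IsCompact (closedBall (0 : E M) (R + 1) ×ˢ closedBall (0 : E M) L) :=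
    (isCompact_closedBall _ _).prod (isCompact_closedBall _ _)
  obtain ⟨ε₀, hε₀, hunif⟩ := Metric.uniformContinuousOn_iff.1
    (hcpt.uniformContinuousOn_of_continuous hF.continuous.continuousOn) η hη
  -- `ε₀` serves the uniform continuity of `F`, `1` keeps translates in the compact set, and `η / (L
  -- + 1)` gives `|w - u| ≤ η`, the `+ 1` covering `L = 0`.
  set ε := min (min ε₀ 1) (η / (L + 1)) with hεdef
  have hε : 0 < ε := by positivity
  have hεL : L * ε ≤ η := by
    have h1 : ε ≤ η / (L + 1) := min_le_right _ _
    rw [le_div_iff₀ (by positivity)] at h1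
    nlinarith
  -- Normalized volume suffices instead of a smooth kernel: since `u` is Lipschitz, one may
  -- differentiate under the integral.
  set μ := ProbabilityTheory.cond (volume : Measure (E M)) (ball 0 ε) with hμ
  have : IsProbabilityMeasure μ := ProbabilityTheory.cond_isProbabilityMeasure_of_finite
    (measure_ball_pos _ _ hε).ne' measure_ball_lt_top.ne
  have hμmem : ∀ᵐ h ∂μ, ‖h‖ < ε := by
    filter_upwards [ProbabilityTheory.ae_cond_mem (μ := (volume : Measure (E M))) measurableSet_ball]
      with h hh
    simpa using hh
  have hμac : μ ≪ volume := ProbabilityTheory.cond_absolutelyContinuous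
  have htrans : ∀ (y : E M) (p : E M → Prop), (∀ᵐ x, p x) → ∀ᵐ h ∂μ, p (y + h) := fun y p hp =>
    hμac.ae_le ((measurePreserving_add_left volume y).quasiMeasurePreserving.ae hp)
  have hclose : ∀ y, ∀ᵐ h ∂μ, ‖u (y + h) - u y‖ ≤ η := by
    intro y
    filter_upwards [hμmem] with h hh
    refine (hu.norm_sub_le _ _).trans ?_
    rw [add_sub_cancel_left]
    exact (mul_le_mul_of_nonneg_left hh.le L.2).trans hεL
  have hmeas : ∀ y, AEStronglyMeasurable (fun h => u (y + h)) μ := fun y =>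
    (hu.continuous.comp (continuous_const.add continuous_id)).aestronglyMeasurable
  have hint : ∀ y, Integrable (fun h => u (y + h)) μ := by
    intro y
    refine Integrable.of_bound (hmeas y) (‖u y‖ + η) ?_
    filter_upwards [hclose y] with h hh
    have := norm_le_norm_add_norm_sub' (u (y + h)) (u y)
    linarith
  set w : E M → ℝ := fun y => ∫ h, u (y + h) ∂μ with hw
  have hdiff : ∀ y, HasFDerivAt w (∫ h, fderiv ℝ u (y + h) ∂μ) y := by
    intro y
    refine (hasFDerivAt_integral_of_dominated_loc_of_lip (bound := fun _ => (L : ℝ)) univ_mem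
      (Eventually.of_forall hmeas) (hint y)
      ((measurable_fderiv ℝ u).comp (measurable_const_add y)).aestronglyMeasurable
      (Eventually.of_forall fun h => ?_) (integrable_const _) ?_).2
    · have hL : Real.nnabs (L : ℝ) = L := by ext; simp
      rw [hL]
      refine (LipschitzWith.of_dist_le_mul fun x z => ?_).lipschitzOnWith
      have := hu.dist_le_mul (x + h) (z + h)
      rwa [dist_add_right] at this
    · filter_upwards [htrans y _ hu.ae_differentiableAt] with h hh
      exact (hasFDerivAt_comp_add_right h).2 hh.hasFDerivAt
  have hgint : ∀ y, Integrable (fun h => gradient u (y + h)) μ := fun y =>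
    Integrable.of_bound ((measurable_gradient u).comp (measurable_const_add y)).aestronglyMeasurable
      L (Eventually.of_forall fun h => norm_gradient_le hu _)
  have hgrad : ∀ y, gradient w y = ∫ h, gradient u (y + h) ∂μ := by
    intro y
    apply ext_inner_left ℝ
    intro t
    have hfint : Integrable (fun h => fderiv ℝ u (y + h)) μ :=
      Integrable.of_bound
        ((measurable_fderiv ℝ u).comp (measurable_const_add y)).aestronglyMeasurable
        L (Eventually.of_forall fun h => norm_fderiv_le_of_lipschitz ℝ hu)
    rw [← integral_inner (hgint y), real_inner_comm, inner_gradient_left, (hdiff y).fderiv,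
      ContinuousLinearMap.integral_apply hfint]
    refine integral_congr_ae (Eventually.of_forall fun h => ?_)
    simp only
    rw [real_inner_comm, inner_gradient_left]
  refine ⟨w, fun y => (hdiff y).differentiableAt, ?_, fun y => ?_, fun y hy => ?_⟩
  · refine LipschitzWith.of_dist_le_mul fun x z => ?_
    rw [dist_eq_norm, hw, ← integral_sub (hint x) (hint z)]
    refine (norm_integral_le_of_norm_le_const (C := L * dist x z)
      (Eventually.of_forall fun h => ?_)).trans (by simp)
    have := hu.dist_le_mul (x + h) (z + h)
    rwa [dist_add_right, dist_eq_norm] at this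
  · have : w y - u y = ∫ h, (u (y + h) - u y) ∂μ := by
      rw [integral_sub (hint y) (integrable_const _)]; simp [hw]
    rw [this, ← Real.norm_eq_abs]
    exact (norm_integral_le_of_norm_le_const (hclose y)).trans (by simp)
  · rw [hgrad]
    -- `gradient w y` averages gradients of `u` at nearby points. Freezing the base point at `y`
    -- costs at most `η`, so almost all of them lie in one closed convex sublevel, and so does their
    -- mean.
    refine (hF.convex (b + η) y).integral_mem (hF.isClosed_sublevel _ _) ?_ (hgint y)
    filter_upwards [htrans y _ hae, hμmem] with h h1 h2
    have hε1 : ε ≤ 1 := (min_le_left _ _).trans (min_le_right _ _)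
    have hεε : ε ≤ ε₀ := (min_le_left _ _).trans (min_le_left _ _)
    have hq : gradient u (y + h) ∈ closedBall (0 : E M) L := by
      simpa using norm_gradient_le hu (y + h)
    have := hunif (y, gradient u (y + h)) ⟨by simp; linarith, hq⟩ (y + h, gradient u (y + h))
      ⟨by simpa using (norm_add_le y h).trans (by linarith), hq⟩
      (by
        rw [Prod.dist_eq, dist_self, dist_self_add_right]
        exact max_lt (h2.trans_le hεε) hε₀)
    have h3 := (abs_lt.1 this).2
    change F y _ ≤ b + η
    change F y _ - F (y + h) _ < η at h3
    linarith

/-- Lipschitz almost everywhere subsolutions are viscosity subsolutions. -/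
theorem IsCoerciveHamiltonian.isSubsolutionOn_of_ae (hF : IsCoerciveHamiltonian F)
    {L : ℝ≥0} (hu : LipschitzWith L u) (hae : ∀ᵐ y, F y (gradient u y) ≤ b) :
    IsSubsolutionOn F b univ u := by
  refine isSubsolutionOn_of_approx hF.continuous hu.continuous fun y =>
    ⟨1, one_pos, fun η hη => ?_⟩
  obtain ⟨w, hwd, -, hwu, hw⟩ := hF.exists_differentiable_approx hu hae (‖y‖ + 1) hη
  refine ⟨w, isSubsolutionOn_of_differentiable hwd fun z hz => hw z ?_, fun z _ => hwu z⟩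
  rw [mem_ball, dist_eq_norm] at hz
  linarith [norm_le_norm_add_norm_sub' z y]

/-! ### Truncation of critical subsolutions -/

theorem gradient_fun_neg (φ : E M → ℝ) (y : E M) :
    gradient (fun z => -φ z) y = -gradient φ y := by
  rw [gradient, fderiv_fun_neg, map_neg, gradient]

/-- A critical subsolution `v` can be truncated by a compactly supported function `φ` that
dominates `|v|` on `C` and has a small gradient outside `C`. -/
theorem IsCoerciveHamiltonian.isSpecialSubsolution_truncation (hF : IsCoerciveHamiltonian F)
    {C K : Set (E M)} {δ : ℝ} (hδ : 0 < δ) {Lφ : ℝ≥0}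
    (hv : ∀ R : ℝ, ∃ L : ℝ≥0, LipschitzOnWith L v (closedBall 0 R))
    (hvd : ∀ y, DifferentiableAt ℝ v y → F y (gradient v y) ≤ criticalValue F)
    (hφ : LipschitzWith Lφ φ) (hφ0 : ∀ y, 0 ≤ φ y) (hvφ : ∀ y ∈ C, |v y| ≤ φ y)
    (hφd : ∀ y, y ∉ C → ∀ q, ‖q‖ ≤ ‖gradient φ y‖ → F y q ≤ criticalValue F)
    (hK : IsCompact K) (hφK : ∀ y, y ∉ K → φ y = 0)
    (hFK : ∀ y, y ∉ K → F y 0 ≤ criticalValue F - δ) :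
    IsSpecialSubsolution F K fun y => max (min (v y) (φ y)) (-φ y) := by
  set w : E M → ℝ := fun y => min (v y) (φ y) with hw
  set u : E M → ℝ := fun y => max (w y) (-φ y) with hu
  have huφ : ∀ y, |u y| ≤ φ y := fun y => abs_le.2 ⟨le_max_right _ _,
    max_le (min_le_right _ _) (by linarith [hφ0 y])⟩
  have hu0 : ∀ y, y ∉ K → u y = 0 := fun y hy => by
    have := huφ y
    rw [hφK y hy] at this
    exact abs_eq_zero.1 (le_antisymm this (abs_nonneg _))
  have hwsub : ∀ x y, |w x - w y| ≤ max |v x - v y| |φ x - φ y| := fun x y =>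
    abs_min_sub_min_le_max _ _ _ _
  have husub : ∀ x y, |u x - u y| ≤ max |v x - v y| |φ x - φ y| := fun x y => by
    refine (abs_max_sub_max_le_max _ _ _ _).trans (max_le (hwsub x y) ?_)
    rw [neg_sub_neg, abs_sub_comm]
    exact le_max_right _ _
  have hφL : ∀ x y, |φ x - φ y| ≤ Lφ * dist x y := fun x y => by
    rw [← Real.dist_eq]; exact hφ.dist_le_mul x y
  have hwlip : ∀ R : ℝ, ∃ L : ℝ≥0, LipschitzOnWith L w (closedBall 0 R) := by
    intro R
    obtain ⟨L, hL⟩ := hv R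
    refine ⟨max L Lφ, LipschitzOnWith.of_dist_le_mul fun x hx y hy => ?_⟩
    rw [Real.dist_eq, NNReal.coe_max, max_mul_of_nonneg _ _ dist_nonneg]
    refine (hwsub x y).trans (max_le_max ?_ (hφL x y))
    rw [← Real.dist_eq]; exact hL.dist_le_mul x hx y hy
  obtain ⟨R, hR⟩ := hK.isBounded.subset_closedBall (0 : E M)
  obtain ⟨Lv, hLv⟩ := hv R
  have hulip : LipschitzWith (max Lv Lφ) u := by
    refine LipschitzWith.of_dist_le_mul fun x y => ?_
    -- `v` is only locally Lipschitz. If one endpoint lies off `K`, then `u` and `φ` vanish there,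
    -- and `|u| ≤ φ` at the other endpoint lets the Lipschitz constant of `φ` take over.
    have hmain : ∀ x y, y ∉ K → |u x - u y| ≤ max (Lv * dist x y) (Lφ * dist x y) := by
      intro x y hy
      refine le_trans ?_ (le_max_right _ _)
      rw [hu0 y hy, sub_zero]
      refine (huφ x).trans ((le_abs_self _).trans ?_)
      have := hφL x y
      rwa [hφK y hy, sub_zero] at this
    rw [Real.dist_eq, NNReal.coe_max, max_mul_of_nonneg _ _ dist_nonneg]
    by_cases hx : x ∈ K
    · by_cases hy : y ∈ K
      · refine (husub x y).trans (max_le_max ?_ (hφL x y))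
        rw [← Real.dist_eq]; exact hLv.dist_le_mul x (hR hx) y (hR hy)
      · exact hmain x y hy
    · rw [abs_sub_comm, dist_comm]
      exact hmain y x hx
  have hae : ∀ᵐ y, F y (gradient u y) ≤ criticalValue F := by
    filter_upwards [ae_differentiableAt_of_locallyLipschitz hv,
      ae_differentiableAt_of_locallyLipschitz hwlip, hφ.ae_differentiableAt,
      hulip.ae_differentiableAt] with y h1 h2 h3 h4
    -- A minimum or maximum of two functions touches the active one from one side, so at a point of
    -- common differentiability the gradients coincide; the contact sets need no further analysis.
    have hwv : w y = v y → gradient w y = gradient v y := fun h =>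
      gradient_eq_of_isLocalMax h2 h1 (Eventually.of_forall fun x => by
        simp only [h, sub_self, sub_nonpos]; exact min_le_left _ _)
    have hwφ : w y = φ y → gradient w y = gradient φ y := fun h =>
      gradient_eq_of_isLocalMax h2 h3 (Eventually.of_forall fun x => by
        simp only [h, sub_self, sub_nonpos]; exact min_le_right _ _)
    have huw : u y = w y → gradient u y = gradient w y := fun h =>
      (gradient_eq_of_isLocalMax h2 h4 (Eventually.of_forall fun x => by
        simp only [h, sub_self, sub_nonpos]; exact le_max_left _ _)).symm
    have huφ' : u y = -φ y → gradient u y = -gradient φ y := fun h => by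
      rw [← gradient_fun_neg]
      exact (gradient_eq_of_isLocalMax h3.fun_neg h4 (Eventually.of_forall fun x => by
        simp only [h, sub_self, sub_nonpos]; exact le_max_right _ _)).symm
    by_cases hy : y ∈ C
    · obtain ⟨h5, h6⟩ := abs_le.1 (hvφ y hy)
      have h7 : w y = v y := min_eq_left h6
      have h8 : u y = w y := max_eq_left (by rw [h7]; exact h5)
      rw [huw h8, hwv h7]
      exact hvd y h1
    · rcases max_choice (w y) (-φ y) with h | h
      · rw [huw h]
        rcases min_choice (v y) (φ y) with h' | h'
        · rw [hwv h']; exact hvd y h1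
        · rw [hwφ h']; exact hφd y hy _ le_rfl
      · rw [huφ' h]
        exact hφd y hy _ (norm_neg _).le
  refine ⟨?_, ⟨_, hulip⟩, hF.isSubsolutionOn_of_ae hulip hae, hu0, δ, hδ,
    hulip.continuous.upperSemicontinuous.upperSemicontinuousOn _, ?_⟩
  · obtain ⟨U, hU⟩ := hK.bddAbove_image hφ.continuous.continuousOn
    refine ⟨max U 0, fun y => (huφ y).trans ?_⟩
    by_cases hy : y ∈ K
    · exact (hU ⟨y, hy, rfl⟩).trans (le_max_left _ _)
    · rw [hφK y hy]; exact le_max_right _ _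
  · rintro y hy ψ ⟨hψ, hψy, hle⟩
    have hg : gradient (fun _ : E M => (0 : ℝ)) y = gradient ψ y := by
      refine gradient_eq_of_isLocalMax (differentiableAt_const _)
        (hψ.differentiable (by simp) y) ?_
      filter_upwards [hle, hK.isClosed.isOpen_compl.mem_nhds hy] with x hx hxK
      rw [hu0 x hxK] at hx
      rw [hψy, hu0 y hy]
      linarith
    rw [← hg, gradient_fun_const]
    exact hFK y hy

theorem abs_log_sub_log_le {s x y : ℝ} (hs : 0 < s) (hx : s ≤ x) (hy : s ≤ y) :
    |Real.log x - Real.log y| ≤ |x - y| / s := by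
  have key : ∀ x y, s ≤ x → s ≤ y → Real.log x - Real.log y ≤ |x - y| / s := by
    intro x y hx hy
    have hx0 := hs.trans_le hx
    have hy0 := hs.trans_le hy
    rw [← Real.log_div hx0.ne' hy0.ne']
    have h1 := Real.log_le_sub_one_of_pos (div_pos hx0 hy0)
    have h2 : x / y - 1 = (x - y) / y := by field_simp
    rw [h2] at h1
    exact h1.trans (div_le_div₀ (abs_nonneg _) (le_abs_self _) hs hy)
  rw [abs_le]
  have h1 := key x y hx hy
  have h2 := key y x hy hx
  rw [abs_sub_comm] at h2
  constructor <;> linarith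

/-- There is a special critical subsolution. -/
theorem IsCoerciveHamiltonian.exists_isSpecialSubsolution (hF : IsCoerciveHamiltonian F) :
    ∃ K : Set (E M), IsCompact K ∧ ∃ u, IsSpecialSubsolution F K u := by
  obtain ⟨v, hv⟩ := hF.exists_critical_subsolution
  obtain ⟨ρ₀, hρ₀⟩ := hF.decay (criticalValue F - 1)
  obtain ⟨G, hG, hgr⟩ := hF.growth
  set ρ := max ρ₀ 0
  have hvlip := hF.lipschitzOnWith hv
  obtain ⟨Lv, hLv⟩ := hvlip ρ
  obtain ⟨m, hm⟩ := (isCompact_closedBall (0 : E M) ρ).bddAbove_image hLv.continuousOn.abs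
  -- The slope of `φ` at `y` is bounded by `2 * ε / (1 + ‖y‖)`, the `2` coming from the estimate `1
  -- + ‖x‖ > (1 + ‖y‖) / 2` near `y`. Hence the gradient costs at most `G * 2 * ε = 1`, the gap
  -- built into `ρ₀`.
  set ε := 1 / (2 * G) with hε
  have hε0 : 0 < ε := by positivity
  -- This makes `φ ≥ m ≥ |v|` on the ball of radius `ρ`, while `φ` vanishes once `log (1 + ‖y‖) ≥ m'
  -- / ε`.
  set m' := m + ε * Real.log (1 + ρ) with hm'
  set φ : E M → ℝ := fun y => max (m' - ε * Real.log (1 + ‖y‖)) 0 with hφ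
  have hφsub : ∀ x y, ∀ s, 0 < s → s ≤ 1 + ‖x‖ → s ≤ 1 + ‖y‖ →
      ‖φ x - φ y‖ ≤ ε / s * ‖x - y‖ := by
    intro x y s hs hx hy
    refine (abs_max_sub_max_le_abs _ _ _).trans ?_
    have h1 := abs_log_sub_log_le hs hx hy
    have h2 : |1 + ‖x‖ - (1 + ‖y‖)| ≤ ‖x - y‖ := by
      rw [add_sub_add_left_eq_sub]; exact abs_norm_sub_norm_le x y
    rw [sub_sub_sub_cancel_left, ← mul_sub, abs_mul, abs_of_pos hε0, abs_sub_comm]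
    calc ε * |Real.log (1 + ‖x‖) - Real.log (1 + ‖y‖)| ≤ ε * (‖x - y‖ / s) := by
          gcongr; exact h1.trans (by gcongr)
      _ = ε / s * ‖x - y‖ := by ring
  have hφlip : LipschitzWith ⟨ε, hε0.le⟩ φ := LipschitzWith.of_dist_le_mul fun x y => by
    rw [dist_eq_norm, dist_eq_norm]
    exact (hφsub x y 1 one_pos (by simp) (by simp)).trans_eq (by rw [div_one]; rfl)
  have hout : ∀ y, y ∉ closedBall (0 : E M) ρ → F y 0 ≤ criticalValue F - 1 := fun y hy => by
    rw [mem_closedBall, dist_zero_right, not_le] at hy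
    exact hρ₀ y ((le_max_left _ _).trans hy.le)
  refine ⟨closedBall 0 (max ρ (Real.exp (m' / ε))), isCompact_closedBall _ _, _,
    hF.isSpecialSubsolution_truncation (C := closedBall 0 ρ) one_pos hvlip
      (fun y hd => hv.le_of_differentiableAt hF.continuous isOpen_univ (mem_univ _) hd) hφlip
      (fun y => le_max_right _ _) ?_ ?_ (isCompact_closedBall _ _) ?_ ?_⟩
  · intro y hy
    refine (hm ⟨y, hy, rfl⟩).trans (le_trans ?_ (le_max_left _ _))
    have : Real.log (1 + ‖y‖) ≤ Real.log (1 + ρ) := by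
      refine Real.log_le_log (by positivity) ?_
      have : ‖y‖ ≤ ρ := by simpa using hy
      linarith
    have := mul_le_mul_of_nonneg_left this hε0.le
    linarith
  · intro y hy q hq
    have hgrad : ‖gradient φ y‖ ≤ ε / ((1 + ‖y‖) / 2) := by
      rw [norm_gradient]
      refine norm_fderiv_le_of_lip' ℝ (by positivity) ?_
      have hcont : Continuous fun x : E M => 1 + ‖x‖ := by fun_prop
      have h1 : ∀ᶠ x : E M in 𝓝 y, (1 + ‖y‖) / 2 < 1 + ‖x‖ :=
        hcont.continuousAt.eventually (lt_mem_nhds (by linarith [norm_nonneg y]))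
      filter_upwards [h1] with x hx
      exact hφsub x y _ (by positivity) hx.le (by linarith [norm_nonneg y])
    have h1 := hout y hy
    have h2 : G * (1 + ‖y‖) * ‖q‖ ≤ 1 := by
      calc G * (1 + ‖y‖) * ‖q‖ ≤ G * (1 + ‖y‖) * (ε / ((1 + ‖y‖) / 2)) := by
            gcongr; exact hq.trans hgrad
        _ = 1 := by
          have : (1 + ‖y‖) ≠ 0 := by positivity
          rw [hε]; field_simp
    linarith [hgr y q]
  · intro y hy
    have hy' : Real.exp (m' / ε) < ‖y‖ := by
      rw [mem_closedBall, dist_zero_right, not_le] at hy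
      exact (le_max_right ρ _).trans_lt hy
    have h1 : m' / ε < Real.log (1 + ‖y‖) := by
      rw [Real.lt_log_iff_exp_lt (by positivity)]
      linarith
    rw [div_lt_iff₀ hε0] at h1
    exact max_eq_right (by linarith)
  · intro y hy
    exact hout y fun h => hy (closedBall_subset_closedBall (le_max_left _ _) h)

theorem isCompact_infDist_le {C : Set (E M)} (hC : IsCompact C) (hne : C.Nonempty) (m : ℝ) :
    IsCompact {y | infDist y C ≤ m} := by
  refine Metric.isCompact_of_isClosed_isBounded
    (isClosed_le (continuous_infDist_pt C) continuous_const) ?_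
  obtain ⟨R, hR⟩ := hC.isBounded.subset_closedBall (0 : E M)
  refine (isBounded_closedBall (x := (0 : E M)) (r := R + m)).subset fun y hy => ?_
  obtain ⟨z, hz, hyz⟩ := hC.exists_infDist_eq_dist hne y
  have h1 : dist y z ≤ m := hyz ▸ hy
  have h2 := mem_closedBall.1 (hR hz)
  exact mem_closedBall.2 ((dist_triangle y z 0).trans (by linarith))

/-- If the field `g` is bounded by `Q`, a critical subsolution with oscillation at most `m` on an
admissible core can be truncated in the `m`-neighborhood of the core. -/
theorem IsCoerciveHamiltonian.exists_isSpecialSubsolution_infDist (hF : IsCoerciveHamiltonian F)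
    {Q m : ℝ} (hQ : 0 < Q) (hgr : ∀ y q, F y q ≤ F y 0 + Q * ‖q‖) {C : Set (E M)}
    (hC : IsAdmissibleCore F Q C) (hne : C.Nonempty)
    (hv : IsSubsolutionOn F (criticalValue F) univ v)
    (hosc : ∀ y ∈ C, ∀ z ∈ C, |v y - v z| ≤ m) :
    ∃ u, IsSpecialSubsolution F {y | infDist y C ≤ m} u := by
  obtain ⟨y₀, hy₀⟩ := hne
  have hm : 0 ≤ m := (abs_nonneg _).trans (hosc y₀ hy₀ y₀ hy₀)
  have hφ : LipschitzWith 1 fun y => max (m - infDist y C) 0 := by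
    refine LipschitzWith.of_dist_le_mul fun x y => (abs_max_sub_max_le_abs _ _ _).trans ?_
    rw [sub_sub_sub_cancel_left, abs_sub_comm, ← Real.dist_eq]
    exact (lipschitz_infDist_pt C).dist_le_mul x y
  -- After subtracting the value at a point of `C`, the oscillation bound becomes `|v| ≤ m` on `C`,
  -- where the cutoff equals `m`.
  have hv' := hv.sub_const (v y₀)
  refine ⟨_, hF.isSpecialSubsolution_truncation (C := C) (v := fun y => v y - v y₀) hQ
    (fun R => hF.lipschitzOnWith hv' R)
    (fun y hd => hv'.le_of_differentiableAt hF.continuous isOpen_univ (mem_univ _) hd) hφ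
    (fun y => le_max_right _ _) ?_ ?_ (isCompact_infDist_le hC.1 ⟨y₀, hy₀⟩ m) ?_ ?_⟩
  · intro y hy
    simpa [infDist_zero_of_mem hy] using Or.inl (hosc y hy y₀ hy₀)
  · intro y hy q hq
    have h1 := hq.trans (norm_gradient_le hφ y)
    have h2 := mul_le_mul_of_nonneg_left h1 hQ.le
    have h3 := hC.2 y hy
    have h4 := hgr y q
    simp only [NNReal.coe_one, mul_one] at h2
    linarith
  · intro y hy
    simp only [mem_ofPred_eq, not_le] at hy
    exact max_eq_right (by linarith)
  · intro y hy
    refine (hC.2 y fun h => hy ?_).le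
    simpa [infDist_zero_of_mem h] using hm

/-! ### The intrinsic distance -/

namespace IsCoerciveHamiltonian

variable (hF : IsCoerciveHamiltonian F)
include hF

/-- Coercivity keeps the `q n` bounded and continuity of `F` puts every cluster point in the
limiting sublevel: the sublevels depend upper semicontinuously on the point and on the level. -/
theorem exists_mem_sublevel_of_tendsto {y q : ℕ → E M} {y₀ : E M} {β : ℕ → ℝ}
    (hy : Tendsto y atTop (𝓝 y₀)) (hβ : Tendsto β atTop (𝓝 b)) (hq : ∀ n, F (y n) (q n) ≤ β n) :
    ∃ q₀ ∈ sublevel F b y₀, ∃ k : ℕ → ℕ, StrictMono k ∧ Tendsto (q ∘ k) atTop (𝓝 q₀) := by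
  obtain ⟨R, hR⟩ := (isBounded_range_of_tendsto y hy).subset_closedBall (0 : E M)
  obtain ⟨T, hT⟩ := hβ.bddAbove_range
  obtain ⟨L, -, hL⟩ := hF.exists_norm_lt R T
  have hqL : ∀ n, q n ∈ ball (0 : E M) L := fun n => by
    simpa using hL (y n) (by simpa using hR (mem_range_self n)) (q n)
      ((hq n).trans (hT (mem_range_self n)))
  obtain ⟨q₀, -, k, hk, hlim⟩ := tendsto_subseq_of_bounded isBounded_ball hqL
  refine ⟨q₀, ?_, k, hk, hlim⟩
  exact le_of_tendsto_of_tendsto ((hF.continuous.tendsto (y₀, q₀)).comp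
    ((hy.comp hk.tendsto_atTop).prodMk_nhds hlim)) (hβ.comp hk.tendsto_atTop)
    (Eventually.of_forall fun n => hq (k n))

theorem isCompact_sublevel (b : ℝ) (y : E M) : IsCompact (sublevel F b y) := by
  obtain ⟨L, -, hL⟩ := hF.exists_norm_lt ‖y‖ b
  refine isCompact_of_isClosed_isBounded (hF.isClosed_sublevel b y)
    ((isBounded_ball (x := (0 : E M)) (r := L)).subset fun q hq => ?_)
  simpa using hL y le_rfl q hq

theorem inner_le_support {y q : E M} (hq : q ∈ sublevel F b y) (v : E M) :
    ⟪q, v⟫ ≤ support F b y v :=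
  le_csSup ((hF.isCompact_sublevel b y).bddAbove_image (by fun_prop)) ⟨q, hq, rfl⟩

theorem exists_inner_eq_support {y : E M} (hne : (sublevel F b y).Nonempty) (v : E M) :
    ∃ q ∈ sublevel F b y, ⟪q, v⟫ = support F b y v :=
  ((hF.isCompact_sublevel b y).image (f := fun q => ⟪q, v⟫) (by fun_prop)).sSup_mem
    (hne.image _)

theorem exists_abs_support_le (hne : ∀ y, (sublevel F b y).Nonempty) (R : ℝ) :
    ∃ L : ℝ, 0 < L ∧ ∀ y : E M, ‖y‖ ≤ R → ∀ v, |support F b y v| ≤ L * ‖v‖ := by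
  obtain ⟨L, hL, h⟩ := hF.exists_norm_lt R b
  refine ⟨L, hL, fun y hy v => ?_⟩
  obtain ⟨q, hq, hqv⟩ := hF.exists_inner_eq_support (hne y) v
  rw [← hqv]
  refine (abs_real_inner_le_norm q v).trans ?_
  gcongr
  exact (h y hy q hq).le

/-- The support function is jointly upper semicontinuous: maximizing vectors along a convergent
sequence subconverge to a competitor at the limit, so superlevel sets are closed. -/
theorem measurable_support (hne : ∀ y, (sublevel F b y).Nonempty) :
    Measurable fun z : E M × E M => support F b z.1 z.2 := by
  refine measurable_of_Ici fun s => IsClosed.measurableSet (IsSeqClosed.isClosed ?_)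
  intro z z₀ hz hlim
  choose q hq hqv using fun n => hF.exists_inner_eq_support (hne (z n).1) (z n).2
  obtain ⟨q₀, hq₀, k, hk, hqlim⟩ := hF.exists_mem_sublevel_of_tendsto
    ((continuous_fst.tendsto z₀).comp hlim) tendsto_const_nhds hq
  refine le_trans ?_ (hF.inner_le_support hq₀ z₀.2)
  have h1 := hqlim.inner (𝕜 := ℝ) (((continuous_snd.tendsto z₀).comp hlim).comp hk.tendsto_atTop)
  refine ge_of_tendsto h1 (Eventually.of_forall fun n => ?_)
  exact (hz (k n)).trans_eq (hqv (k n)).symm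

theorem measurable_support_comp (hne : ∀ y, (sublevel F b y).Nonempty) {α β : ℝ → E M}
    (hα : Measurable α) (hβ : Measurable β) : Measurable fun t => support F b (α t) (β t) := by
  have h := hα.prodMk hβ
  exact (hF.measurable_support hne).comp h

theorem eventually_inner_lt_support {y : E M} {q : ℕ → E M} {β : ℕ → ℝ}
    (hβ : Tendsto β atTop (𝓝 b)) (hq : ∀ n, F y (q n) ≤ β n) (v : E M) {s : ℝ}
    (hs : support F b y v < s) : ∀ᶠ n in atTop, ⟪q n, v⟫ < s := by
  by_contra hcon
  obtain ⟨k, hk, hle⟩ := extraction_of_frequently_atTop (not_eventually.1 hcon)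
  obtain ⟨q₀, hq₀, j, -, hlim⟩ := hF.exists_mem_sublevel_of_tendsto (q := q ∘ k)
    (tendsto_const_nhds (x := y)) (hβ.comp hk.tendsto_atTop) fun n => hq (k n)
  have h1 : s ≤ ⟪q₀, v⟫ := ge_of_tendsto (hlim.inner (𝕜 := ℝ) tendsto_const_nhds)
    (Eventually.of_forall fun n => not_lt.1 (hle (j n)))
  linarith [hF.inner_le_support hq₀ v]

variable {L : ℝ≥0} (hu : LipschitzWith L u) (hsub : IsSubsolutionOn F b univ u)
include hu hsub

theorem ae_le_of_isSubsolutionOn : ∀ᵐ y, F y (gradient u y) ≤ b := by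
  filter_upwards [hu.ae_differentiableAt] with y hy
  exact hsub.le_of_differentiableAt hF.continuous isOpen_univ (mem_univ y) hy

theorem exists_seq_approx (R : ℝ) : ∃ w : ℕ → E M → ℝ, ∀ n, Differentiable ℝ (w n) ∧
    LipschitzWith L (w n) ∧ (∀ y, |w n y - u y| ≤ 1 / ((n : ℝ) + 1)) ∧
      ∀ y, ‖y‖ ≤ R → F y (gradient (w n) y) ≤ b + 1 / ((n : ℝ) + 1) := by
  choose w hw using fun n : ℕ => hF.exists_differentiable_approx hu
    (hF.ae_le_of_isSubsolutionOn hu hsub) R (show 0 < 1 / ((n : ℝ) + 1) by positivity)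
  exact ⟨w, hw⟩

/-- A subsolution need not be differentiable at a prescribed `y`, but its smoothed versions are, and
their gradients at `y` cluster in the sublevel. -/
theorem sublevel_nonempty (y : E M) : (sublevel F b y).Nonempty := by
  obtain ⟨w, hw⟩ := hF.exists_seq_approx hu hsub ‖y‖
  obtain ⟨q, hq, -⟩ := hF.exists_mem_sublevel_of_tendsto (tendsto_const_nhds (x := y))
    (by simpa using tendsto_one_div_add_atTop_nhds_zero_nat.const_add b)
    fun n => (hw n).2.2.2 y le_rfl
  exact ⟨q, hq⟩

/-- A subsolution increases along a curve by at most the intrinsic length of the curve. -/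
theorem sub_le_intrinsicLength {ξ : ℝ → E M} {K : ℝ≥0} (hξ : LipschitzOnWith K ξ (Icc 0 1)) :
    u (ξ 1) - u (ξ 0) ≤ intrinsicLength F b ξ := by
  obtain ⟨R, hR⟩ :=
    (isCompact_Icc.image_of_continuousOn hξ.continuousOn).isBounded.subset_closedBall (0 : E M)
  have hξR : ∀ t ∈ Icc (0 : ℝ) 1, ‖ξ t‖ ≤ R := fun t ht => by
    simpa using hR (mem_image_of_mem ξ ht)
  have hne := hF.sublevel_nonempty hu hsub
  obtain ⟨B, hB, hσB⟩ := hF.exists_abs_support_le hne R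
  -- The curve may run inside the null set where `u` is not differentiable, so the chain rule is
  -- applied to differentiable approximations.
  obtain ⟨w, hw⟩ := hF.exists_seq_approx hu hsub R
  set σ : ℝ → ℝ := fun t => support F b (ξ t) (deriv ξ t) with hσ
  set d : ℕ → ℝ → ℝ := fun n => deriv (w n ∘ ξ) with hd
  have hac : ∀ n, AbsolutelyContinuousOnInterval (w n ∘ ξ) 0 1 := fun n => by
    refine LipschitzOnWith.absolutelyContinuousOnInterval (K := L * K) ?_
    rw [uIcc_of_le zero_le_one]
    exact (hw n).2.1.comp_lipschitzOnWith hξ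
  have hgood : ∀ᵐ t : ℝ, t ∈ uIoc (0 : ℝ) 1 → DifferentiableAt ℝ ξ t ∧ t ∈ Icc (0 : ℝ) 1 ∧
      ‖deriv ξ t‖ ≤ K := by
    -- The endpoint `1` belongs to `uIoc 0 1` but `Icc 0 1` is not a neighbourhood of it, so it is
    -- discarded as a null set.
    filter_upwards [hξ.ae_differentiableWithinAt_of_mem_real, Measure.ae_ne volume (1 : ℝ)]
      with t h1 h2 ht
    rw [uIoc_of_le zero_le_one] at ht
    have hnhds : Icc (0 : ℝ) 1 ∈ 𝓝 t := Icc_mem_nhds ht.1 (lt_of_le_of_ne ht.2 h2)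
    exact ⟨(h1 (Ioc_subset_Icc_self ht)).differentiableAt hnhds, Ioc_subset_Icc_self ht,
      norm_deriv_le_of_lipschitzOn hnhds hξ⟩
  have hdval : ∀ n t, DifferentiableAt ℝ ξ t → d n t = ⟪gradient (w n) (ξ t), deriv ξ t⟫ := by
    intro n t ht
    rw [inner_gradient_left]
    exact (((hw n).1 (ξ t)).hasFDerivAt.comp_hasDerivAt t ht.hasDerivAt).deriv
  have hσmeas : AEStronglyMeasurable σ (volume.restrict (uIoc (0 : ℝ) 1)) := by
    -- Nothing is known about `ξ` outside `[0,1]`; composing with the projection onto the interval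
    -- gives a continuous curve on the whole line.
    have h1 : Continuous fun t => ξ (projIcc (0 : ℝ) 1 zero_le_one t) :=
      hξ.continuousOn.comp_continuous
        (f := fun t => (projIcc (0 : ℝ) 1 zero_le_one t : ℝ))
        (continuous_subtype_val.comp continuous_projIcc) fun t => Subtype.coe_prop _
    have h2 : Measurable fun t => support F b (ξ (projIcc (0 : ℝ) 1 zero_le_one t)) (deriv ξ t) :=
      hF.measurable_support_comp hne h1.measurable (measurable_deriv ξ)
    refine h2.aestronglyMeasurable.congr ?_
    refine (ae_restrict_iff' measurableSet_uIoc).2 (Eventually.of_forall fun t ht => ?_)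
    rw [uIoc_of_le zero_le_one] at ht
    simp only [hσ]
    rw [projIcc_of_mem zero_le_one (Ioc_subset_Icc_self ht)]
  have hσle : ∀ t, t ∈ Icc (0 : ℝ) 1 → ‖deriv ξ t‖ ≤ K → |σ t| ≤ B * K := fun t ht hK =>
    (hσB _ (hξR t ht) _).trans (by gcongr)
  have hdle : ∀ n t, DifferentiableAt ℝ ξ t → ‖deriv ξ t‖ ≤ K → |d n t| ≤ L * K := by
    intro n t ht hK
    rw [hdval n t ht]
    refine (abs_real_inner_le_norm _ _).trans ?_
    gcongr
    exact norm_gradient_le (hw n).2.1 _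
  have hdmeas : ∀ n, Measurable (d n) := fun n => measurable_deriv _
  have hbound : ∀ n, ∀ᵐ t : ℝ, t ∈ uIoc (0 : ℝ) 1 → ‖max (d n t) (σ t)‖ ≤ max (L * K : ℝ) (B * K) := by
    intro n
    filter_upwards [hgood] with t ht htI
    obtain ⟨h1, h2, h3⟩ := ht htI
    exact abs_max_le_max_abs_abs.trans (max_le_max (hdle n t h1 h3) (hσle t h2 h3))
  have hmaxmeas : ∀ n, AEStronglyMeasurable (fun t => max (d n t) (σ t))
      (volume.restrict (uIoc (0 : ℝ) 1)) := fun n =>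
    (hdmeas n).aestronglyMeasurable.sup hσmeas
  -- The derivatives `d n` need not converge; only their upper limit is bounded by `σ`. Their
  -- maximum with `σ` does converge to `σ`, so dominated convergence applies.
  have hlim : Tendsto (fun n => ∫ t in (0 : ℝ)..1, max (d n t) (σ t)) atTop
      (𝓝 (∫ t in (0 : ℝ)..1, σ t)) := by
    refine intervalIntegral.tendsto_integral_filter_of_dominated_convergence
      (fun _ => max (L * K : ℝ) (B * K)) (Eventually.of_forall hmaxmeas)
      (Eventually.of_forall hbound) intervalIntegrable_const ?_
    filter_upwards [hgood] with t ht htI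
    obtain ⟨h1, h2, h3⟩ := ht htI
    rw [tendsto_order]
    refine ⟨fun s hs => Eventually.of_forall fun n => lt_max_of_lt_right hs, fun s hs => ?_⟩
    filter_upwards [hF.eventually_inner_lt_support (q := fun n => gradient (w n) (ξ t))
      (by simpa using tendsto_one_div_add_atTop_nhds_zero_nat.const_add b)
      (fun n => (hw n).2.2.2 (ξ t) (hξR t h2)) _ hs] with n hn
    exact max_lt (by rw [hdval n t h1]; exact hn) hs
  have hle : ∀ n, w n (ξ 1) - w n (ξ 0) ≤ ∫ t in (0 : ℝ)..1, max (d n t) (σ t) := by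
    intro n
    have h1 := (hac n).integral_deriv_eq_sub
    simp only [Function.comp_apply] at h1
    rw [← h1]
    refine intervalIntegral.integral_mono_on zero_le_one (hac n).intervalIntegrable_deriv ?_
      fun t _ => le_max_left _ _
    refine (intervalIntegrable_const (c := max (L * K : ℝ) (B * K))).mono_fun (hmaxmeas n) ?_
    refine (ae_restrict_iff' measurableSet_uIoc).2 ?_
    filter_upwards [hbound n] with t ht htI
    exact (ht htI).trans (le_abs_self _)
  have hwlim : ∀ y, Tendsto (fun n => w n y) atTop (𝓝 (u y)) := by
    intro y
    rw [tendsto_iff_dist_tendsto_zero]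
    refine squeeze_zero (fun _ => dist_nonneg) (fun n => ?_)
      tendsto_one_div_add_atTop_nhds_zero_nat
    rw [Real.dist_eq]
    exact (hw n).2.2.1 y
  exact le_of_tendsto_of_tendsto ((hwlim _).sub (hwlim _)) hlim (Eventually.of_forall hle)

theorem sub_le_of_mem_lengths {y₁ y₂ : E M} {s : ℝ}
    (hs : s ∈ {s | ∃ ξ : ℝ → E M, (∃ L : ℝ≥0, LipschitzOnWith L ξ (Icc 0 1)) ∧
      ξ 0 = y₁ ∧ ξ 1 = y₂ ∧ s = intrinsicLength F b ξ}) : u y₂ - u y₁ ≤ s := by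
  obtain ⟨ξ, ⟨K, hK⟩, rfl, rfl, rfl⟩ := hs
  exact hF.sub_le_intrinsicLength hu hsub hK

/-- The increment of a subsolution bounds all lengths from below, so the infimum is genuine although
`σ` may be negative; the straight segment bounds it from above. -/
theorem abs_intrinsicDist_le (R : ℝ) : ∃ B : ℝ, ∀ y₁ y₂ : E M, ‖y₁‖ ≤ R → ‖y₂‖ ≤ R →
    u y₂ - u y₁ ≤ intrinsicDist F b y₁ y₂ ∧ intrinsicDist F b y₁ y₂ ≤ B * ‖y₂ - y₁‖ := by
  obtain ⟨B, hB, hσB⟩ := hF.exists_abs_support_le (hF.sublevel_nonempty hu hsub) R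
  refine ⟨B, fun y₁ y₂ h₁ h₂ => ?_⟩
  set ξ : ℝ → E M := fun t => y₁ + t • (y₂ - y₁) with hξ
  have hderiv : ∀ t, HasDerivAt ξ (y₂ - y₁) t := fun t => by
    simpa [hξ] using ((hasDerivAt_id t).smul_const (y₂ - y₁)).const_add y₁
  have hlip : LipschitzWith ‖y₂ - y₁‖₊ ξ :=
    lipschitzWith_of_nnnorm_deriv_le (fun t => (hderiv t).differentiableAt)
      fun t => by rw [(hderiv t).deriv]
  have hmem : intrinsicLength F b ξ ∈ {s | ∃ ξ : ℝ → E M,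
      (∃ L : ℝ≥0, LipschitzOnWith L ξ (Icc 0 1)) ∧ ξ 0 = y₁ ∧ ξ 1 = y₂ ∧
        s = intrinsicLength F b ξ} :=
    ⟨ξ, ⟨_, hlip.lipschitzOnWith⟩, by simp [hξ], by simp [hξ], rfl⟩
  constructor
  · exact le_csInf ⟨_, hmem⟩ fun s hs => hF.sub_le_of_mem_lengths hu hsub hs
  · refine (csInf_le ⟨_, fun s hs => hF.sub_le_of_mem_lengths hu hsub hs⟩ hmem).trans ?_
    refine (le_abs_self _).trans ?_
    have hseg : ∀ t ∈ Icc (0 : ℝ) 1, ‖ξ t‖ ≤ R := fun t ht => by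
      have h3 : ξ t ∈ closedBall (0 : E M) R :=
        (convex_closedBall (0 : E M) R).add_smul_sub_mem (by simpa using h₁) (by simpa using h₂) ht
      simpa using h3
    have := intervalIntegral.norm_integral_le_of_norm_le_const (a := 0) (b := 1)
      (C := B * ‖y₂ - y₁‖) (f := fun t => support F b (ξ t) (deriv ξ t)) fun t ht => by
        rw [uIoc_of_le zero_le_one] at ht
        rw [(hderiv t).deriv]
        exact hσB _ (hseg t (Ioc_subset_Icc_self ht)) _
    simpa [intrinsicLength] using this

/-- The oscillation of a subsolution on a compact set is at most `max |S|`. -/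
theorem abs_sub_le_sSup_intrinsicDist {C : Set (E M)} (hC : IsCompact C) {y z : E M}
    (hy : y ∈ C) (hz : z ∈ C) :
    |u y - u z| ≤ sSup ((fun z : E M × E M => |intrinsicDist F b z.1 z.2|) '' (C ×ˢ C)) := by
  obtain ⟨R, hR⟩ := hC.isBounded.subset_closedBall (0 : E M)
  have hCR : ∀ x ∈ C, ‖x‖ ≤ R := fun x hx => by simpa using hR hx
  obtain ⟨B, hB⟩ := hF.abs_intrinsicDist_le hu hsub R
  -- Boundedness is essential: the real `sSup` of an unbounded set is `0` and would control nothing.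
  have hbdd : BddAbove ((fun z : E M × E M => |intrinsicDist F b z.1 z.2|) '' (C ×ˢ C)) := by
    refine ⟨(L + |B|) * (2 * R), ?_⟩
    rintro _ ⟨⟨x₁, x₂⟩, ⟨h₁, h₂⟩, rfl⟩
    obtain ⟨h3, h4⟩ := hB x₁ x₂ (hCR _ h₁) (hCR _ h₂)
    have h5 : ‖x₂ - x₁‖ ≤ 2 * R :=
      (norm_sub_le _ _).trans (by linarith [hCR _ h₁, hCR _ h₂])
    have h6 := (abs_le.1 ((Real.norm_eq_abs _).symm.trans_le (hu.norm_sub_le x₂ x₁))).1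
    have h7 : B * ‖x₂ - x₁‖ ≤ |B| * (2 * R) :=
      mul_le_mul (le_abs_self B) h5 (norm_nonneg _) (abs_nonneg B)
    have h8 : L * ‖x₂ - x₁‖ ≤ L * (2 * R) := mul_le_mul_of_nonneg_left h5 L.2
    have h9 : 0 ≤ L * ‖x₂ - x₁‖ := by positivity
    have h10 : 0 ≤ |B| * (2 * R) :=
      mul_nonneg (abs_nonneg B) ((norm_nonneg _).trans h5)
    simp only
    rw [abs_le]
    constructor <;> nlinarith
  have key : ∀ y ∈ C, ∀ z ∈ C, u y - u z ≤
      sSup ((fun z : E M × E M => |intrinsicDist F b z.1 z.2|) '' (C ×ˢ C)) := by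
    intro y hy z hz
    exact ((hB z y (hCR z hz) (hCR y hy)).1.trans (le_abs_self _)).trans
      (le_csSup hbdd ⟨(z, y), ⟨hz, hy⟩, rfl⟩)
  rw [abs_le]
  constructor
  · linarith [key z hz y hy]
  · exact key y hy z hz

end IsCoerciveHamiltonian

/-! ### The Hamiltonian of the cell problem -/

namespace StandingAssumptions

variable {N m : ℕ} {A : Set (E m)} {f : E N → E M → E m → E N} {g : E N → E M → E m → E M}
  {l : E N → E M → E m → ℝ} {Q₀ : ℝ} (hyp : StandingAssumptions A f g l Q₀) (x₀ p₀ : E N)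
include hyp

theorem control_nonempty : A.Nonempty := by
  obtain ⟨r, hr, h⟩ := hyp.controllable {(0, 0)} isCompact_singleton
  by_contra hA
  rw [not_nonempty_iff_eq_empty] at hA
  have := h (0, 0) rfl (mem_ball_self hr)
  simp [hA] at this

theorem continuousOn_uncurry_f : ContinuousOn (fun z : E M × E m => f x₀ z.1 z.2) (univ ×ˢ A) := by
  obtain ⟨L, hL, h⟩ := hyp.lipschitz
  refine continuousOn_prod_of_continuousOn_lipschitzOnWith _ ⟨L, hL.le⟩
    (fun y _ => hyp.continuousOn_f x₀ y)
    fun a ha => LipschitzOnWith.of_dist_le_mul fun y _ z _ => ?_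
  rw [dist_eq_norm, dist_eq_norm]
  have h1 := (h x₀ x₀ y z a ha).1
  rw [sub_self, norm_zero, zero_add] at h1
  exact h1

theorem continuousOn_uncurry_g : ContinuousOn (fun z : E M × E m => g x₀ z.1 z.2) (univ ×ˢ A) := by
  obtain ⟨L, hL, h⟩ := hyp.lipschitz
  refine continuousOn_prod_of_continuousOn_lipschitzOnWith _ ⟨L, hL.le⟩
    (fun y _ => hyp.continuousOn_g x₀ y)
    fun a ha => LipschitzOnWith.of_dist_le_mul fun y _ z _ => ?_
  rw [dist_eq_norm, dist_eq_norm]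
  have h1 := (h x₀ x₀ y z a ha).2
  rw [sub_self, norm_zero, zero_add] at h1
  exact h1

theorem continuousOn_uncurry_l : ContinuousOn (fun z : E M × E m => l x₀ z.1 z.2) (univ ×ˢ A) :=
  hyp.continuousOn_l.comp (f := fun z : E M × E m => (x₀, z.1, z.2)) (by fun_prop)
    fun _ hz => ⟨mem_univ _, mem_univ _, hz.2⟩

theorem continuousOn_integrand :
    ContinuousOn (fun z : (E M × E M) × E m =>
      -⟪p₀, f x₀ z.1.1 z.2⟫ - ⟪z.1.2, g x₀ z.1.1 z.2⟫ - l x₀ z.1.1 z.2) (univ ×ˢ A) := by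
  have hmaps : MapsTo (fun z : (E M × E M) × E m => (z.1.1, z.2)) (univ ×ˢ A) (univ ×ˢ A) :=
    fun _ hz => ⟨mem_univ _, hz.2⟩
  have hcont : ContinuousOn (fun z : (E M × E M) × E m => (z.1.1, z.2)) (univ ×ˢ A) := by
    fun_prop
  have h1 := (hyp.continuousOn_uncurry_f x₀).comp hcont hmaps
  have h2 := (hyp.continuousOn_uncurry_g x₀).comp hcont hmaps
  have h3 := (hyp.continuousOn_uncurry_l x₀).comp hcont hmaps
  exact ((continuousOn_const.inner h1).neg.sub
    (ContinuousOn.inner (f := fun z : (E M × E M) × E m => z.1.2) (by fun_prop) h2)).sub h3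

theorem continuous_hamiltonian :
    Continuous fun z : E M × E M => hamiltonian A f g l x₀ z.1 p₀ z.2 := by
  have : CompactSpace A := isCompact_iff_compactSpace.1 hyp.isCompact
  have hc : Continuous ↿fun (z : E M × E M) (a : A) =>
      -⟪p₀, f x₀ z.1 a⟫ - ⟪z.2, g x₀ z.1 a⟫ - l x₀ z.1 a :=
    (hyp.continuousOn_integrand x₀ p₀).comp_continuous
      (f := fun z : (E M × E M) × A => (z.1, (z.2 : E m))) (by fun_prop)
      fun z => ⟨mem_univ _, z.2.2⟩
  have := isCompact_univ.continuous_sSup hc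
  convert this using 2 with z
  rw [hamiltonian, image_univ, image_eq_range]

theorem hamiltonian_le_iff (hA : A.Nonempty) {y q : E M} {b : ℝ} :
    hamiltonian A f g l x₀ y p₀ q ≤ b ↔
      ∀ a ∈ A, -⟪p₀, f x₀ y a⟫ - ⟪q, g x₀ y a⟫ - l x₀ y a ≤ b := by
  have hbdd := hyp.isCompact.bddAbove_image
    (f := fun a => -⟪p₀, f x₀ y a⟫ - ⟪q, g x₀ y a⟫ - l x₀ y a)
    ((hyp.continuousOn_integrand x₀ p₀).comp (f := fun a => ((y, q), a)) (by fun_prop)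
      fun a ha => ⟨mem_univ _, ha⟩)
  rw [hamiltonian, csSup_le_iff hbdd (hA.image _), forall_mem_image]

theorem abs_inner_f_le (y : E M) {a : E m} (ha : a ∈ A) : |⟪p₀, f x₀ y a⟫| ≤ ‖p₀‖ * Q₀ :=
  (abs_real_inner_le_norm _ _).trans
    (mul_le_mul_of_nonneg_left (hyp.norm_f_le x₀ y a ha) (norm_nonneg _))

theorem hamiltonian_le_of_norm_g_le (hA : A.Nonempty) {y : E M} {G : ℝ}
    (hG : ∀ a ∈ A, ‖g x₀ y a‖ ≤ G) (q : E M) :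
    hamiltonian A f g l x₀ y p₀ q ≤ hamiltonian A f g l x₀ y p₀ 0 + G * ‖q‖ := by
  rw [hyp.hamiltonian_le_iff x₀ p₀ hA]
  intro a ha
  have h1 := (hyp.hamiltonian_le_iff x₀ p₀ hA (y := y) (q := 0)).1 le_rfl a ha
  rw [inner_zero_left] at h1
  have h2 := (abs_le.1 (abs_real_inner_le_norm q (g x₀ y a))).1
  have h3 := mul_le_mul_of_nonneg_left (hG a ha) (norm_nonneg q)
  linarith

/-- The bound on `-⟪q, v⟫` for `v` in `g x₀ y '' A` is a closed half-space condition, so it extends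
to the closed convex hull and hence to a ball of radius `r`. Testing with `v = -(r / 2) q / ‖q‖`,
inside the open ball, gives slope `r / 2`. -/
theorem hamiltonian_coercive (hA : A.Nonempty) (R : ℝ) : ∃ r : ℝ, 0 < r ∧ ∃ C : ℝ,
    ∀ y : E M, ‖y‖ ≤ R → ∀ q, r * ‖q‖ - C ≤ hamiltonian A f g l x₀ y p₀ q := by
  obtain ⟨r, hr, hball⟩ := hyp.controllable ({x₀} ×ˢ closedBall 0 R)
    (isCompact_singleton.prod (isCompact_closedBall _ _))
  obtain ⟨T, hT⟩ := ((isCompact_closedBall (0 : E M) R).prod hyp.isCompact).bddAbove_image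
    ((hyp.continuousOn_uncurry_l x₀).mono (prod_mono_left (subset_univ _)))
  refine ⟨r / 2, by positivity, ‖p₀‖ * Q₀ + T, fun y hy q => ?_⟩
  set s := hamiltonian A f g l x₀ y p₀ q with hs
  have hyR : y ∈ closedBall (0 : E M) R := by simpa using hy
  have hhalf : ∀ v ∈ closure (convexHull ℝ (g x₀ y '' A)), -⟪q, v⟫ ≤ s + (‖p₀‖ * Q₀ + T) := by
    have hcl : IsClosed {v : E M | -⟪q, v⟫ ≤ s + (‖p₀‖ * Q₀ + T)} :=
      isClosed_le (by fun_prop) continuous_const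
    have hcv : Convex ℝ {v : E M | -⟪q, v⟫ ≤ s + (‖p₀‖ * Q₀ + T)} :=
      convex_halfSpace_le (f := fun v => -⟪q, v⟫)
        ⟨fun v w => by rw [inner_add_right]; ring,
          fun k v => by rw [inner_smul_right, smul_eq_mul]; ring⟩ _
    refine closure_minimal (convexHull_min ?_ hcv) hcl
    rintro _ ⟨a, ha, rfl⟩
    have h1 := (hyp.hamiltonian_le_iff x₀ p₀ hA (y := y) (q := q)).1 le_rfl a ha
    have h2 := (abs_le.1 (hyp.abs_inner_f_le x₀ p₀ y ha)).2
    have h3 : l x₀ y a ≤ T := hT ⟨(y, a), ⟨hyR, ha⟩, rfl⟩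
    change -⟪q, g x₀ y a⟫ ≤ _
    linarith
  rcases eq_or_ne q 0 with rfl | hq
  · have := hhalf 0 (hball (x₀, y) ⟨rfl, hyR⟩ (mem_ball_self hr))
    rw [inner_zero_right] at this
    rw [norm_zero]
    linarith
  · have hq0 : 0 < ‖q‖ := norm_pos_iff.2 hq
    have hmem : (-(r / 2 / ‖q‖)) • q ∈ ball (0 : E M) r := by
      rw [mem_ball, dist_zero_right, norm_smul, norm_neg, norm_div, norm_norm,
        div_mul_cancel₀ _ hq0.ne', Real.norm_eq_abs, abs_of_pos (by positivity)]
      linarith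
    have := hhalf _ (hball (x₀, y) ⟨rfl, hyR⟩ hmem)
    rw [inner_smul_right, real_inner_self_eq_norm_sq] at this
    have h4 : -(-(r / 2 / ‖q‖) * ‖q‖ ^ 2) = r / 2 * ‖q‖ := by field_simp
    rw [h4] at this
    linarith

theorem exists_norm_g_le : ∃ G : ℝ, 0 < G ∧ ∀ y, ∀ a ∈ A, ‖g x₀ y a‖ ≤ G * (1 + ‖y‖) := by
  obtain ⟨L, hL, h⟩ := hyp.lipschitz
  obtain ⟨T, hT⟩ := hyp.isCompact.bddAbove_image (hyp.continuousOn_g x₀ 0).norm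
  refine ⟨max T L, lt_max_of_lt_right hL, fun y a ha => ?_⟩
  have h1 : ‖g x₀ 0 a‖ ≤ T := hT ⟨a, ha, rfl⟩
  have h2 := (h x₀ x₀ y 0 a ha).2
  rw [sub_self, norm_zero, zero_add, sub_zero] at h2
  have h3 := norm_le_norm_add_norm_sub' (g x₀ y a) (g x₀ 0 a)
  have h4 := mul_le_mul_of_nonneg_right (le_max_right T L) (norm_nonneg y)
  have h5 := le_max_left T L
  linarith

theorem isCoerciveHamiltonian :
    IsCoerciveHamiltonian fun y q => hamiltonian A f g l x₀ y p₀ q := by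
  have hA := hyp.control_nonempty
  refine ⟨hyp.continuous_hamiltonian x₀ p₀, fun b y => ?_, hyp.hamiltonian_coercive x₀ p₀ hA,
    fun T => ?_, ?_⟩
  · intro q hq q' hq' s t hs ht hst
    rw [sublevel, mem_ofPred_eq, hyp.hamiltonian_le_iff x₀ p₀ hA] at hq hq' ⊢
    intro a ha
    have h1 := mul_le_mul_of_nonneg_left (hq a ha) hs
    have h2 := mul_le_mul_of_nonneg_left (hq' a ha) ht
    rw [inner_add_left, real_inner_smul_left, real_inner_smul_left]
    have h3 : s * b + t * b = b := by rw [← add_mul, hst, one_mul]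
    have h4 : t = 1 - s := by linarith
    subst h4
    linarith
  · obtain ⟨ρ, hρ⟩ := hyp.coercive {x₀} isCompact_singleton (‖p₀‖ * Q₀ - T)
    refine ⟨ρ, fun y hy => (hyp.hamiltonian_le_iff x₀ p₀ hA).2 fun a ha => ?_⟩
    have h1 := hρ y hy x₀ rfl a ha
    have h2 := (abs_le.1 (hyp.abs_inner_f_le x₀ p₀ y ha)).1
    rw [inner_zero_left]
    linarith
  · obtain ⟨G, hG, h⟩ := hyp.exists_norm_g_le x₀
    exact ⟨G, hG, fun y q => hyp.hamiltonian_le_of_norm_g_le x₀ p₀ hA (h y) q⟩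

/-- Controllability puts a ball inside the closed hull of values of norm at most `Q₀`; since `M >
0`, that ball contains a nonzero vector. -/
theorem bound_pos (hM : 0 < M) (hg : ∀ y, ∀ a ∈ A, ‖g x₀ y a‖ ≤ Q₀) : 0 < Q₀ := by
  obtain ⟨r, hr, h⟩ := hyp.controllable {(x₀, 0)} isCompact_singleton
  have hball : ball (0 : E M) r ⊆ closedBall 0 Q₀ := by
    refine (h (x₀, 0) rfl).trans (closure_minimal (convexHull_min ?_ (convex_closedBall _ _))
      isClosed_closedBall)
    rintro _ ⟨a, ha, rfl⟩
    simpa using hg 0 a ha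
  have hv : EuclideanSpace.single (⟨0, hM⟩ : Fin M) (r / 2) ∈ ball (0 : E M) r := by
    rw [mem_ball, dist_zero_right, PiLp.norm_single, Real.norm_eq_abs,
      abs_of_pos (by positivity)]
    linarith
  have h1 := hball hv
  rw [mem_closedBall, dist_zero_right, PiLp.norm_single, Real.norm_eq_abs,
    abs_of_pos (by positivity)] at h1
  linarith

end StandingAssumptions

/-! ### Existence and nonemptiness of admissible cores -/

namespace IsCoerciveHamiltonian

variable (hF : IsCoerciveHamiltonian F)
include hF

theorem exists_isAdmissibleCore (Q : ℝ) : ∃ C, IsAdmissibleCore F Q C := by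
  obtain ⟨ρ, hρ⟩ := hF.decay (criticalValue F - Q - 1)
  refine ⟨closedBall 0 ρ, isCompact_closedBall _ _, fun y hy => ?_⟩
  rw [mem_closedBall, dist_zero_right, not_le] at hy
  linarith [hρ y hy.le]

/-- Otherwise compactness and the decay at infinity would give `F y 0 ≤ b` for all `y` with some `b`
below the critical value, and constants would be subsolutions at level `b`. -/
theorem exists_criticalValue_le_zero : ∃ y, criticalValue F ≤ F y 0 := by
  obtain ⟨ρ, hρ⟩ := hF.decay (criticalValue F - 1)
  obtain ⟨y, -, hy⟩ := (isCompact_closedBall (0 : E M) (max ρ 0)).exists_isMaxOn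
    ⟨0, by simp⟩ hF.continuous_zero.continuousOn
  by_contra! hcon
  have hmem : max (F y 0) (criticalValue F - 1) ∈ subsolutionLevels F := by
    refine mem_subsolutionLevels fun z => ?_
    rcases le_total ‖z‖ ρ with h | h
    · exact (hy (by simp [h])).trans (le_max_left _ _)
    · exact (hρ z h).trans (le_max_right _ _)
  have h1 := hF.isGLB_criticalValue.1 hmem
  exact absurd h1 (not_le.2 (max_lt (hcon y) (by linarith)))

/-- This rules out a degenerate case: `infDist` to the empty set is `0`, so the neighborhood of an
empty core would be the whole space. -/
theorem nonempty_of_isAdmissibleCore {Q : ℝ} (hQ : 0 < Q) {C : Set (E M)}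
    (hC : IsAdmissibleCore F Q C) : C.Nonempty := by
  obtain ⟨y, hy⟩ := hF.exists_criticalValue_le_zero
  refine ⟨y, by_contra fun h => ?_⟩
  linarith [hC.2 y h]

end IsCoerciveHamiltonian

end CellProblem

/-- Fix the slow variable `x₀` and its momentum `p₀`, let `H₀(y,q) = H(x₀,y,p₀,q)` and let `c₀`
be its critical value, which is a genuine (finite) infimum. There is a bounded Lipschitz
critical subsolution vanishing and strict outside some compact set; and if `Q₀` bounds also
`|g(x₀,·,·)|`, then this compact set can be taken to be `K₀`, for any choice of `C`. -/
theorem proposition3p8 {N M m : ℕ} (hM : 0 < M) (A : Set (CellProblem.E m))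
    (f : CellProblem.E N → CellProblem.E M → CellProblem.E m → CellProblem.E N)
    (g : CellProblem.E N → CellProblem.E M → CellProblem.E m → CellProblem.E M)
    (l : CellProblem.E N → CellProblem.E M → CellProblem.E m → ℝ) (Q₀ : ℝ)
    (hyp : CellProblem.StandingAssumptions A f g l Q₀)
    (x₀ p₀ : CellProblem.E N)
    (H₀ : CellProblem.E M → CellProblem.E M → ℝ)
    (hH₀ : ∀ y q, H₀ y q = CellProblem.hamiltonian A f g l x₀ y p₀ q) :
    IsGLB (CellProblem.subsolutionLevels H₀) (CellProblem.criticalValue H₀) ∧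
    (∃ K : Set (CellProblem.E M), IsCompact K ∧
      ∃ u : CellProblem.E M → ℝ, CellProblem.IsSpecialSubsolution H₀ K u) ∧
    ((∀ y, ∀ a ∈ A, ‖g x₀ y a‖ ≤ Q₀) →
      (∃ C : Set (CellProblem.E M), CellProblem.IsAdmissibleCore H₀ Q₀ C) ∧
      ∀ C : Set (CellProblem.E M), CellProblem.IsAdmissibleCore H₀ Q₀ C →
        IsCompact (CellProblem.coreNeighborhood H₀ C) ∧
        ∃ u : CellProblem.E M → ℝ,
          CellProblem.IsSpecialSubsolution H₀ (CellProblem.coreNeighborhood H₀ C) u) := by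
  obtain rfl : H₀ = fun y q => CellProblem.hamiltonian A f g l x₀ y p₀ q :=
    funext fun y => funext (hH₀ y)
  have hF := hyp.isCoerciveHamiltonian x₀ p₀
  obtain ⟨K, hK, v, hv⟩ := hF.exists_isSpecialSubsolution
  refine ⟨hF.isGLB_criticalValue, ⟨K, hK, v, hv⟩, fun hg =>
    ⟨hF.exists_isAdmissibleCore Q₀, fun C hC => ?_⟩⟩
  have hQ := hyp.bound_pos x₀ hM hg
  have hne := hF.nonempty_of_isAdmissibleCore hQ hC
  -- The special subsolution already found is truncated again: unlike a general critical subsolution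
  -- it is globally Lipschitz, as the comparison with the intrinsic distance requires.
  obtain ⟨-, ⟨L, hL⟩, hsub, -⟩ := hv
  exact ⟨CellProblem.isCompact_infDist_le hC.1 hne _,
    hF.exists_isSpecialSubsolution_infDist hQ
      (fun y q => hyp.hamiltonian_le_of_norm_g_le x₀ p₀ hyp.control_nonempty (hg y) q) hC hne
      hsub fun y hy z hz => hF.abs_sub_le_sSup_intrinsicDist hL hsub hC.1 hy hz⟩
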